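/- Let $\mathbf S^1=\mathbf R/2\pi\mathbf Z$, let $\mathbf S^2\subset\mathbf R^3$ be the unit sphere, and let $\gamma\colon\mathbf S^1\to\mathbf S^2$ be a $\mathcal C^2$ closed curve that is simple (injective) and regular ($\gamma'(t)\neq 0$ for all $t$). Suppose that its image $\Gamma:=\gamma(\mathbf S^1)$ lies in a closed hemisphere of $\mathbf S^2$ and contains the origin of $\mathbf R^3$ in its convex hull. Let - $\mathcal S$ be the number of singular points of $\gamma$, i.e. of $t$ with $\gamma'(t)=0$ (so $\mathcal S=0$ here); - $\mathcal I$ be the number of inflections of $\gamma$, i.e. of regular points $t$ at which the geodesic curvature $k=\langle\gamma'',\gamma\times\gamma'\rangle/\|\gamma'\|^3$ of $\gamma$ in $\mathbf S^2$ vanishes; - $\mathcal D$ be the number of unordered pairs of points $t\neq s$ in $\mathbf S^1$ with $\gamma(t)=\pm\gamma(s)$; - $\mathcal D^+\le\mathcal D$ be the number of unordered pairs of points $t\neq s$ in $\mathbf S^1$ with $\gamma(t)=\gamma(s)$ (so $\mathcal D^+=0$ here); each of these numbers may be infinite. Then $$2(\mathcal D+\mathcal S)+\mathcal I\ge 6\qquad\text{and}\qquad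 2(\mathcal D^++\mathcal S)+\mathcal I\ge 4.$$ Furthermore, if $\Gamma$ is symmetric, i.e. $\Gamma=-\Gamma$, then $$2(\mathcal D^++\mathcal S)+\mathcal I\ge 6.$$ Finally, if $\gamma$ has only finitely many inflections, then all of these statements remain true when $\mathcal I$ denotes the number of genuine inflections, where an inflection is called genuine if it has a connected open neighborhood in $\mathbf S^1$ on which $k$ vanishes just once and changes sign. -/

import Mathlib

noncomputable section

namespace SphericalCurve

/-- Euclidean 3-space. -/
abbrev E3 : Type := EuclideanSpace ℝ (Fin 3)

/-- The unit sphere of Euclidean 3-space. -/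
abbrev S2 : Type := Metric.sphere (0 : E3) 1

/-- The circle `ℝ / 2πℤ`. -/
abbrev S1 : Type := AddCircle (2 * Real.pi)

/-- The cross product of Euclidean 3-space. -/
def cross (u v : E3) : E3 := WithLp.toLp 2 (crossProduct u.ofLp v.ofLp)

/-- `γ` is of class `C²`: its `2π`-periodic lift to the line is `C²` as a map into 3-space. -/
def IsC2 (γ : S1 → S2) : Prop := ContDiff ℝ 2 (fun x : ℝ => (γ (x : S1) : E3))

/-- The velocity `γ'(t)`. -/
def velocity (γ : S1 → S2) (t : S1) : E3 :=
  deriv (fun x : ℝ => (γ (t + (x : S1)) : E3)) 0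

/-- The acceleration `γ''(t)` in 3-space. -/
def acceleration (γ : S1 → S2) (t : S1) : E3 :=
  iteratedDeriv 2 (fun x : ℝ => (γ (t + (x : S1)) : E3)) 0

/-- `t` is a singular point of the (differentiable) curve `γ`. -/
def IsSingularPoint (γ : S1 → S2) (t : S1) : Prop := velocity γ t = 0

/-- `γ` is regular: it has no singular points. -/
def IsRegular (γ : S1 → S2) : Prop := ∀ t, ¬ IsSingularPoint γ t

/-- The geodesic curvature `k = ⟨γ'', γ × γ'⟩ / ‖γ'‖³` of `γ` in the sphere at a regular point, with
respect to the unit normal field `γ × γ' / ‖γ'‖`. Meaningless at singular points. -/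
def geodesicCurvature (γ : S1 → S2) (t : S1) : ℝ :=
  inner ℝ (acceleration γ t) (cross (γ t : E3) (velocity γ t)) / ‖velocity γ t‖ ^ 3

/-- An inflection is a regular point at which the geodesic curvature vanishes. -/
def IsInflection (γ : S1 → S2) (t : S1) : Prop :=
  ¬ IsSingularPoint γ t ∧ geodesicCurvature γ t = 0

/-- An inflection is genuine if it has a connected open neighborhood, consisting of regular points,
in which the geodesic curvature vanishes just once and changes sign. -/
def IsGenuineInflection (γ : S1 → S2) (t : S1) : Prop :=
  IsInflection γ t ∧
    ∃ U : Set S1, IsOpen U ∧ IsConnected U ∧ t ∈ U ∧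
      (∀ s ∈ U, ¬ IsSingularPoint γ s) ∧
      (∀ s ∈ U, geodesicCurvature γ s = 0 → s = t) ∧
      (∃ a ∈ U, ∃ b ∈ U, geodesicCurvature γ a < 0 ∧ 0 < geodesicCurvature γ b)

/-- The number `𝒮` of singular points. -/
def numSingular (γ : S1 → S2) : ℕ∞ := {t : S1 | IsSingularPoint γ t}.encard

/-- The number `ℐ` of inflections. -/
def numInflections (γ : S1 → S2) : ℕ∞ := {t : S1 | IsInflection γ t}.encard

/-- The number of genuine inflections. -/
def numGenuineInflections (γ : S1 → S2) : ℕ∞ := {t : S1 | IsGenuineInflection γ t}.encard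

/-- The number `𝒟` of (unordered) pairs of points `t ≠ s` with `γ t = ± γ s`. -/
def numPairs (γ : S1 → S2) : ℕ∞ :=
  {z : Sym2 S1 | ∃ t s : S1, z = s(t, s) ∧ t ≠ s ∧ (γ t = γ s ∨ γ t = -γ s)}.encard

/-- The number `𝒟⁺` of (unordered) pairs of points `t ≠ s` with `γ t = γ s`. -/
def numDoublePairs (γ : S1 → S2) : ℕ∞ :=
  {z : Sym2 S1 | ∃ t s : S1, z = s(t, s) ∧ t ≠ s ∧ γ t = γ s}.encard

/-- The closed hemisphere of the sphere centered at `u`. -/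
def closedHemisphere (u : S2) : Set S2 := {p | 0 ≤ inner ℝ (u : E3) (p : E3)}

/-- The image of `γ` lies in a closed hemisphere. -/
def LiesInHemisphere (γ : S1 → S2) : Prop := ∃ u : S2, Set.range γ ⊆ closedHemisphere u

/-- The convex hull of the image of `γ` contains the origin. -/
def OriginInConvexHull (γ : S1 → S2) : Prop :=
  (0 : E3) ∈ convexHull ℝ (Set.range fun t => (γ t : E3))

/-- The image `Γ` of `γ` is symmetric: `Γ = -Γ`. -/
def IsSymmetric (γ : S1 → S2) : Prop := Set.range γ = Set.range fun t => -γ t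

end SphericalCurve

end

open Set Filter Topology

noncomputable section

namespace SphericalCurve

/-! Place the hemisphere above the equator and write the curve as height `f ≥ 0` and horizontal part
`z`. A convex combination giving the origin can only use points of height zero, so the origin of the
plane lies in the hull of the contacts with the equator. By Carathéodory, some contacts form an
antipodal pair or a triangle strictly around the origin. The equator is then cut into two half
circles, or into three arcs shorter than π.

Suppose there are finitely many inflections. At a contact the curve is tangent to the equator and
stays above it, so if it moves counterclockwise, its curvature is positive just before and just
after the contact. The core is `exists_curv_neg`: between two contacts whose angles satisfy `A < B ≤
A + π` the curvature becomes negative. Each such arc therefore carries two genuine inflections. A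
triangle gives six. An antipodal pair gives four, and the pair itself contributes the missing 2.

Negative curvature comes from a Hopf Umlaufsatz argument (`exists_curv_neg_of_adjacent`). In the
gnomonic projection `z / f`, an arc between adjacent contacts comes from infinity in direction `A`
and leaves to infinity in direction `B`. The angle of the secants, extended to the tangents on the
diagonal of `a ≤ s ≤ t ≤ b`, fixes the branch: with nonnegative curvature the tangent angle starts
at `A + π` or more, ends at `B` or less, and never decreases. Since `B ≤ A + π` it is constant, so
the curvature vanishes on an interval.

That contacts are met in the order of their positions and in one common direction uses simplicity a
second time. The secant vector `φ(s) z(t) - φ(t) z(s)` is nonzero on a rectangle of times off its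
corners, so its angle is continuous there. Following this angle along the sides excludes the wrong
direction of motion (`not_clockwise_of_ordered`).

With infinitely many inflections the inequalities for all inflections are trivial. A symmetric curve
in a hemisphere lies on the equator, so its curvature vanishes identically. -/

/-! ### Continuous choices of angle for plane vectors -/

/-- The component of `w` in the direction with angle `α`. -/
def dirComp (α : ℝ) (w : ℂ) : ℝ := Real.cos α * w.re + Real.sin α * w.im

/-- `θ` is an angle (argument) of `w`. -/
def IsAngle (θ : ℝ) (w : ℂ) : Prop := w = ‖w‖ * Complex.exp (θ * Complex.I)

theorem IsAngle.re {θ : ℝ} {w : ℂ} (h : IsAngle θ w) : w.re = ‖w‖ * Real.cos θ := by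
  have := congrArg Complex.re h
  simpa [Complex.exp_ofReal_mul_I_re, Complex.exp_ofReal_mul_I_im] using this

theorem IsAngle.im {θ : ℝ} {w : ℂ} (h : IsAngle θ w) : w.im = ‖w‖ * Real.sin θ := by
  have := congrArg Complex.im h
  simpa [Complex.exp_ofReal_mul_I_re, Complex.exp_ofReal_mul_I_im] using this

theorem isAngle_of_eq {θ r : ℝ} {w : ℂ} (hr : 0 ≤ r) (h : w = r * Complex.exp (θ * Complex.I)) :
    IsAngle θ w := by
  have : ‖w‖ = r := by
    rw [h, norm_mul, Complex.norm_exp_ofReal_mul_I, Complex.norm_real, Real.norm_of_nonneg hr,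
      mul_one]
  rw [IsAngle, this]; exact h

theorem IsAngle.dirComp {θ : ℝ} {w : ℂ} (h : IsAngle θ w) (α : ℝ) :
    dirComp α w = ‖w‖ * Real.cos (θ - α) := by
  rw [SphericalCurve.dirComp, h.re, h.im, Real.cos_sub]; ring

theorem dirComp_smul (α r : ℝ) (w : ℂ) : dirComp α (r * w) = r * dirComp α w := by
  simp [dirComp]; ring

theorem dirComp_sub (α : ℝ) (v w : ℂ) : dirComp α (v - w) = dirComp α v - dirComp α w := by
  simp [dirComp]; ring

theorem continuous_dirComp (α : ℝ) : Continuous (dirComp α) := by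
  unfold dirComp; fun_prop

/-- Angles of one nonzero vector differ by multiples of 2π. This turns a rough bound on a continuous
angle, obtained at a corner, into its exact value. -/
theorem IsAngle.eq_of_abs_lt {θ η : ℝ} {w : ℂ} (h : IsAngle θ w) (h' : IsAngle η w) (hw : w ≠ 0)
    (hlt : |θ - η| < 2 * Real.pi) : θ = η := by
  have hn : (‖w‖ : ℂ) ≠ 0 := by simpa using hw
  have h1 : Complex.exp (θ * Complex.I) = Complex.exp (η * Complex.I) := by
    apply mul_left_cancel₀ hn
    exact (Eq.symm h).trans h'
  have hc : Real.cos (θ - η) = 1 := by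
    have a := congrArg Complex.re h1
    have b := congrArg Complex.im h1
    rw [Complex.exp_ofReal_mul_I_re, Complex.exp_ofReal_mul_I_re] at a
    rw [Complex.exp_ofReal_mul_I_im, Complex.exp_ofReal_mul_I_im] at b
    rw [Real.cos_sub, a, b]; nlinarith [Real.sin_sq_add_cos_sq η]
  have := (Real.cos_eq_one_iff_of_lt_of_lt (by linarith [abs_lt.1 hlt]) (abs_lt.1 hlt).2).1 hc
  linarith

theorem IsAngle.add_pi {θ : ℝ} {w : ℂ} (h : IsAngle θ w) : IsAngle (θ + Real.pi) (-w) := by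
  rw [IsAngle, norm_neg, Complex.ofReal_add, add_mul, Complex.exp_add, Complex.exp_pi_mul_I]
  rw [IsAngle] at h
  rw [mul_neg_one, mul_neg, ← h]

theorem IsAngle.real_mul {θ : ℝ} {w : ℂ} (h : IsAngle θ w) {r : ℝ} (hr : 0 ≤ r) :
    IsAngle θ (r * w) := by
  refine isAngle_of_eq (r := r * ‖w‖) (by positivity) ?_
  rw [IsAngle] at h
  rw [Complex.ofReal_mul, mul_assoc, ← h]

/-- A continuous nowhere vanishing complex function on a convex set has a continuous choice of
angle. -/
theorem exists_continuousOn_angle {E : Type*} [NormedAddCommGroup E] [NormedSpace ℝ E] {S : Set E}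
    (hS : Convex ℝ S) {D : E → ℂ} (hD : ContinuousOn D S) (h0 : ∀ x ∈ S, D x ≠ 0)
    {x₀ : E} (hx₀ : x₀ ∈ S) {θ₀ : ℝ} (hθ₀ : IsAngle θ₀ (D x₀)) :
    ∃ θ : E → ℝ, ContinuousOn θ S ∧ (∀ x ∈ S, IsAngle (θ x) (D x)) ∧ θ x₀ = θ₀ := by
  have cov := Complex.isCoveringMap_exp
  -- Contracting the convex set straight to `x₀` gives a homotopy from the constant map to `D`,
  -- which lifts through the covering `exp`.
  let path : unitInterval × S → S := fun q =>
    ⟨(1 - (q.1 : ℝ)) • x₀ + (q.1 : ℝ) • (q.2 : E),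
      hS hx₀ q.2.2 (sub_nonneg.2 q.1.2.2) q.1.2.1 (by ring)⟩
  have hpath : Continuous path := by
    refine Continuous.subtype_mk ?_ _
    fun_prop
  let G : S → {z : ℂ // z ≠ 0} := fun x => ⟨D x, h0 x x.2⟩
  have hG : Continuous G := Continuous.subtype_mk (continuousOn_iff_continuous_domRestrict.1 hD) _
  let H : C(unitInterval × S, {z : ℂ // z ≠ 0}) := ⟨G ∘ path, hG.comp hpath⟩
  let e₀ : ℂ := Real.log ‖D x₀‖ + θ₀ * Complex.I
  have he₀ : Complex.exp e₀ = D x₀ := by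
    have hn : 0 < ‖D x₀‖ := norm_pos_iff.2 (h0 x₀ hx₀)
    rw [Complex.exp_add, ← Complex.ofReal_exp, Real.exp_log hn]
    exact hθ₀.symm
  have hH0 : ∀ a, H (0, a) = ⟨Complex.exp ((ContinuousMap.const S e₀) a),
      Complex.exp_ne_zero _⟩ := by
    intro a
    apply Subtype.ext
    simp [H, G, path, he₀]
  let L := cov.liftHomotopy H (ContinuousMap.const S e₀) hH0
  have hL : ∀ a : S, Complex.exp (L (1, a)) = D a := by
    intro a
    have := congrFun (cov.liftHomotopy_lifts H (ContinuousMap.const S e₀) hH0) (1, a)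
    have := congrArg Subtype.val this
    refine this.trans ?_
    simp [H, G, path]
  classical
  let Lc : C(S, ℂ) := L.comp ⟨fun a => ((1 : unitInterval), a), by fun_prop⟩
  -- Over `x₀` the homotopy is a constant path, so by uniqueness its lift is constant. This fixes
  -- the branch of the angle.
  have hconst : L (1, ⟨x₀, hx₀⟩) = e₀ := by
    have hc : Continuous fun t : unitInterval => L (t, ⟨x₀, hx₀⟩) :=
      L.continuous.comp (by fun_prop)
    have h0 : L (0, ⟨x₀, hx₀⟩) = e₀ := cov.liftHomotopy_zero H _ hH0 _
    have := cov.eq_of_comp_eq (A := unitInterval)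
      (g₁ := fun t : unitInterval => L (t, ⟨x₀, hx₀⟩)) (g₂ := fun _ => e₀) hc continuous_const
      (by
        funext t
        have h1 := congrFun (cov.liftHomotopy_lifts H (ContinuousMap.const S e₀) hH0) (t, ⟨x₀, hx₀⟩)
        refine h1.trans ?_
        apply Subtype.ext
        simp only [H, G, path, ContinuousMap.coe_mk, Function.comp]
        rw [he₀, ← add_smul]; simp) 0 h0
    exact congrFun this 1
  refine ⟨fun x => if h : x ∈ S then (Lc ⟨x, h⟩).im else 0, ?_, ?_, ?_⟩
  · rw [continuousOn_iff_continuous_domRestrict]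
    have : S.domRestrict (fun x => if h : x ∈ S then (Lc ⟨x, h⟩).im else 0) = fun a => (Lc a).im := by
      funext a; simp
    rw [this]; fun_prop
  · intro x hx
    simp only [hx, dite_true]
    refine isAngle_of_eq (r := Real.exp (Lc ⟨x, hx⟩).re) (Real.exp_pos _).le ?_
    rw [Complex.ofReal_exp, ← Complex.exp_add, Complex.re_add_im]
    exact (hL ⟨x, hx⟩).symm
  · simp only [hx₀, dite_true]
    change (L (1, ⟨x₀, hx₀⟩)).im = θ₀
    rw [hconst]; simp [e₀]

/-- A continuous function with nonnegative cosine stays in `[-π/2, π/2]`. -/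
theorem abs_le_pi_div_two_of_cos_nonneg {X : Type*} [TopologicalSpace X] {S : Set X}
    (hS : IsPreconnected S) {θ : X → ℝ} (hθ : ContinuousOn θ S)
    (hcos : ∀ x ∈ S, 0 ≤ Real.cos (θ x)) {x y : X} (hx : x ∈ S) (hy : y ∈ S)
    (h : |θ x| ≤ Real.pi / 2) : |θ y| ≤ Real.pi / 2 := by
  by_contra! hlt
  have hpi := Real.pi_pos
  have hiv := hS.intermediate_value hx hy hθ.abs
  -- The cap at π keeps the intermediate value inside the interval (π/2, π], where the cosine is
  -- negative.
  obtain ⟨w, hw, hw'⟩ := hiv (show min |θ y| Real.pi ∈ Icc |θ x| |θ y| from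
    ⟨le_min (by linarith) (by linarith), min_le_left _ _⟩)
  have := hcos w hw
  rw [← Real.cos_abs, show |θ w| = _ from hw'] at this
  have h1 : Real.pi / 2 < min |θ y| Real.pi := lt_min hlt (by linarith)
  have := Real.cos_neg_of_pi_div_two_lt_of_lt h1 (by linarith [min_le_right |θ y| Real.pi])
  linarith

/-- A vector that stays in the closed half-plane with inner normal `α` cannot wind: once its angle
is within π/2 of `α` it remains so. All passages around corners use this. -/
theorem abs_angle_sub_le {X : Type*} [TopologicalSpace X] {S Q : Set X}
    {D : X → ℂ} {θ : X → ℝ} (hθ : ContinuousOn θ S) (hang : ∀ x ∈ S, IsAngle (θ x) (D x))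
    (h0 : ∀ x ∈ S, D x ≠ 0) (hQS : Q ⊆ S) (hQ : IsPreconnected Q) {α : ℝ}
    (hα : ∀ x ∈ Q, 0 ≤ dirComp α (D x)) {x y : X} (hx : x ∈ Q) (hy : y ∈ Q)
    (h : |θ x - α| ≤ Real.pi / 2) : |θ y - α| ≤ Real.pi / 2 := by
  refine abs_le_pi_div_two_of_cos_nonneg hQ (θ := fun x => θ x - α)
    ((hθ.mono hQS).sub continuousOn_const) (fun q hq => ?_) hx hy h
  have h1 := hα q hq
  rw [(hang q (hQS hq)).dirComp] at h1
  exact nonneg_of_mul_nonneg_right h1 (norm_pos_iff.2 (h0 q (hQS hq)))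

/-- If all values have a common angle, then the continuous angle is constant. -/
theorem angle_eq_of_isAngle {X : Type*} [TopologicalSpace X] {S Q : Set X}
    {D : X → ℂ} {θ : X → ℝ} (hθ : ContinuousOn θ S) (hang : ∀ x ∈ S, IsAngle (θ x) (D x))
    (h0 : ∀ x ∈ S, D x ≠ 0) (hQS : Q ⊆ S) (hQ : IsPreconnected Q) {α : ℝ}
    (hα : ∀ x ∈ Q, IsAngle α (D x)) {x y : X} (hx : x ∈ Q) (hy : y ∈ Q)
    (h : θ x = α) : θ y = α := by
  have hpi := Real.pi_pos
  have := abs_angle_sub_le hθ hang h0 hQS hQ (α := α) (fun q hq => by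
    rw [(hα q hq).dirComp]; simp) hx hy (by rw [h]; simp; positivity)
  exact (hang y (hQS hy)).eq_of_abs_lt (hα y hy) (h0 y (hQS hy)) (by linarith)

/-! ### Secant vectors over a rectangle of times -/

/-- The secant vector of the curve `(z, φ)`, projected along the first factor. -/
def secant (z : ℝ → ℂ) (φ : ℝ → ℝ) (q : ℝ × ℝ) : ℂ := φ q.1 * z q.2 - φ q.2 * z q.1

theorem dirComp_secant (α : ℝ) (z : ℝ → ℂ) (φ : ℝ → ℝ) (q : ℝ × ℝ) :
    dirComp α (secant z φ q) = φ q.1 * dirComp α (z q.2) - φ q.2 * dirComp α (z q.1) := by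
  rw [secant, dirComp_sub, dirComp_smul, dirComp_smul]

theorem continuous_secant {z : ℝ → ℂ} {φ : ℝ → ℝ} (hz : Continuous z) (hφ : Continuous φ) :
    Continuous (secant z φ) := by
  unfold secant; fun_prop

/-- Since the weights `φ` are nonnegative, separating `z s` from `z t` by a line through the origin
confines the secant vector to a half-plane. -/
theorem dirComp_secant_nonneg {z : ℝ → ℂ} {φ : ℝ → ℝ} {p q : ℝ × ℝ} {α : ℝ}
    (hφ : ∀ t, 0 ≤ φ t)
    (h1 : ∀ s ∈ uIcc p.1 q.1, dirComp α (z s) ≤ 0) (h2 : ∀ t ∈ uIcc p.2 q.2, 0 ≤ dirComp α (z t)) :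
    ∀ x ∈ segment ℝ p q, 0 ≤ dirComp α (secant z φ x) := by
  intro x hx
  have hx1 : x.1 ∈ uIcc p.1 q.1 := by
    rw [← segment_eq_uIcc]; exact (Prod.segment_subset (𝕜 := ℝ) p q hx).1
  have hx2 : x.2 ∈ uIcc p.2 q.2 := by
    rw [← segment_eq_uIcc]; exact (Prod.segment_subset (𝕜 := ℝ) p q hx).2
  rw [dirComp_secant]
  have := mul_nonneg (hφ x.1) (h2 _ hx2)
  have := mul_nonneg (hφ x.2) (neg_nonneg.2 (h1 _ hx1))
  linarith

/-- The rectangle `[a, b] × [b, c]` without its corners. -/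
def cornerlessRect (a b c : ℝ) : Set (ℝ × ℝ) :=
  {q | (a ≤ q.1 ∧ q.1 ≤ b) ∧ (b ≤ q.2 ∧ q.2 ≤ c) ∧ 0 < (q.1 - a) + (q.2 - b) ∧
    0 < (q.1 - a) + (c - q.2) ∧ 0 < (b - q.1) + (q.2 - b) ∧ 0 < (b - q.1) + (c - q.2)}

theorem pos_of_convex_comb {x y u v : ℝ} (hu : 0 ≤ u) (hv : 0 ≤ v) (huv : u + v = 1)
    (hx : 0 < x) (hy : 0 < y) : 0 < u * x + v * y := by
  rcases hu.eq_or_lt with rfl | hu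
  · have : v = 1 := by linarith
    subst this; linarith
  · have := mul_pos hu hx
    have := mul_nonneg hv hy.le
    linarith

theorem nonneg_of_convex_comb {x y u v : ℝ} (hu : 0 ≤ u) (hv : 0 ≤ v)
    (hx : 0 ≤ x) (hy : 0 ≤ y) : 0 ≤ u * x + v * y := by positivity

theorem convex_cornerlessRect (a b c : ℝ) : Convex ℝ (cornerlessRect a b c) := by
  rintro p ⟨⟨p1, p2⟩, ⟨p3, p4⟩, p5, p6, p7, p8⟩ q ⟨⟨q1, q2⟩, ⟨q3, q4⟩, q5, q6, q7, q8⟩ u v hu hv huv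
  have hv' : v = 1 - u := by linarith
  simp only [cornerlessRect, mem_ofPred_eq, Prod.fst_add, Prod.snd_add, Prod.smul_fst, Prod.smul_snd,
    smul_eq_mul]
  have h1 := nonneg_of_convex_comb hu hv (sub_nonneg.2 p1) (sub_nonneg.2 q1)
  have h2 := nonneg_of_convex_comb hu hv (sub_nonneg.2 p2) (sub_nonneg.2 q2)
  have h3 := nonneg_of_convex_comb hu hv (sub_nonneg.2 p3) (sub_nonneg.2 q3)
  have h4 := nonneg_of_convex_comb hu hv (sub_nonneg.2 p4) (sub_nonneg.2 q4)
  have h5 := pos_of_convex_comb hu hv huv p5 q5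
  have h6 := pos_of_convex_comb hu hv huv p6 q6
  have h7 := pos_of_convex_comb hu hv huv p7 q7
  have h8 := pos_of_convex_comb hu hv huv p8 q8
  subst hv'
  refine ⟨⟨?_, ?_⟩, ⟨?_, ?_⟩, ?_, ?_, ?_, ?_⟩ <;> linarith

/-- The direction is the bisector of `A` and `B` turned by a quarter turn, so the line along the
bisector separates the two vectors. The companion lemma below treats the other side. -/
theorem IsAngle.dirComp_neg_of_corner {A B : ℝ} {w : ℂ} (h : IsAngle A w) (hw : w ≠ 0)
    (h1 : A < B) (h2 : B < A + 2 * Real.pi) : SphericalCurve.dirComp ((A + B) / 2 + Real.pi / 2) w < 0 := by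
  rw [h.dirComp, show A - ((A + B) / 2 + Real.pi / 2) = -((B - A) / 2 + Real.pi / 2) by ring,
    Real.cos_neg, Real.cos_add_pi_div_two]
  have := mul_pos (norm_pos_iff.2 hw) (Real.sin_pos_of_pos_of_lt_pi
    (show 0 < (B - A) / 2 by linarith) (by linarith))
  linarith

theorem IsAngle.dirComp_pos_of_corner {A B : ℝ} {w : ℂ} (h : IsAngle B w) (hw : w ≠ 0)
    (h1 : A < B) (h2 : B < A + 2 * Real.pi) : 0 < SphericalCurve.dirComp ((A + B) / 2 + Real.pi / 2) w := by
  rw [h.dirComp, show B - ((A + B) / 2 + Real.pi / 2) = (B - A) / 2 - Real.pi / 2 by ring,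
    Real.cos_sub_pi_div_two]
  exact mul_pos (norm_pos_iff.2 hw) (Real.sin_pos_of_pos_of_lt_pi
    (show 0 < (B - A) / 2 by linarith) (by linarith))

theorem eventually_dirComp_nonpos {z : ℝ → ℂ} (hz : Continuous z) {α a : ℝ}
    (h : dirComp α (z a) < 0) : ∀ᶠ s in 𝓝 a, dirComp α (z s) ≤ 0 :=
  (((continuous_dirComp α).comp hz).continuousAt.eventually_lt_const h).mono fun _ h => h.le

theorem eventually_dirComp_nonneg {z : ℝ → ℂ} (hz : Continuous z) {α a : ℝ}
    (h : 0 < dirComp α (z a)) : ∀ᶠ s in 𝓝 a, 0 ≤ dirComp α (z s) :=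
  (((continuous_dirComp α).comp hz).continuousAt.eventually_const_lt h).mono fun _ h => h.le

theorem exists_Icc_right {P : ℝ → Prop} {a b : ℝ} (hab : a < b) (h : ∀ᶠ s in 𝓝[≥] a, P s) :
    ∃ u ∈ Ioo a b, ∀ s ∈ Icc a u, P s := by
  obtain ⟨u, hu, hs⟩ := (mem_nhdsGE_iff_exists_Icc_subset).1 h
  refine ⟨min u ((a + b) / 2), ⟨lt_min hu (by linarith), ?_⟩, fun s hs' => hs ⟨hs'.1, ?_⟩⟩
  · exact (min_le_right _ _).trans_lt (by linarith)
  · exact hs'.2.trans (min_le_left _ _)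

theorem exists_Icc_left {P : ℝ → Prop} {a b : ℝ} (hab : a < b) (h : ∀ᶠ s in 𝓝[≤] b, P s) :
    ∃ u ∈ Ioo a b, ∀ s ∈ Icc u b, P s := by
  obtain ⟨u, hu, hs⟩ := (mem_nhdsLE_iff_exists_Icc_subset).1 h
  refine ⟨max u ((a + b) / 2), ⟨?_, max_lt hu (by linarith)⟩, fun s hs' => hs ⟨?_, hs'.2⟩⟩
  · exact lt_of_lt_of_le (by linarith) (le_max_right _ _)
  · exact (le_max_left _ _).trans hs'.1

/-- The winding number of the secant vector around a rectangle `[a, b] × [b, c]`, where `a`, `b`, `c`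
are zeros of `φ` whose positions are in counterclockwise order, excludes a clockwise passage at `b`. -/
theorem not_clockwise_of_ordered {z : ℝ → ℂ} {φ : ℝ → ℝ} (hz : Continuous z) (hφ : Continuous φ)
    (hφ0 : ∀ t, 0 ≤ φ t) {a b c : ℝ} (hab : a < b) (hbc : b < c)
    (ha0 : φ a = 0) (hb0 : φ b = 0) (hc0 : φ c = 0)
    (hpos₁ : ∀ s ∈ Ioo a b, 0 < φ s) (hpos₂ : ∀ s ∈ Ioo b c, 0 < φ s)
    (hne : ∀ s ∈ Ioo a b, ∀ t ∈ Ioo b c, secant z φ (s, t) ≠ 0)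
    (hza : z a ≠ 0) (hzb : z b ≠ 0) (hzc : z c ≠ 0)
    {A B C : ℝ} (hA : IsAngle A (z a)) (hB : IsAngle B (z b)) (hC : IsAngle C (z c))
    (hAB : A < B) (hBC : B < C) (hCA : C ≤ A + 2 * Real.pi)
    (hac₁ : ∀ᶠ s in 𝓝[≥] a, dirComp ((A + C) / 2 + Real.pi / 2) (z s) ≤ 0)
    (hac₂ : ∀ᶠ s in 𝓝[≤] c, 0 ≤ dirComp ((A + C) / 2 + Real.pi / 2) (z s))
    (hb₁ : ∀ᶠ s in 𝓝[≤] b, dirComp (B - Real.pi / 2) (z s) ≤ 0)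
    (hb₂ : ∀ᶠ s in 𝓝[≥] b, 0 ≤ dirComp (B - Real.pi / 2) (z s)) : False := by
  have hpi := Real.pi_pos
  -- The four times mark off neighbourhoods of the corners small enough for the half-plane criterion
  -- to apply.
  obtain ⟨a₁, ha₁, Ha⟩ := exists_Icc_right hab (hac₁.and (nhdsWithin_le_nhds
    (eventually_dirComp_nonpos hz (hA.dirComp_neg_of_corner hza hAB (by linarith)))))
  obtain ⟨b₀, hb₀, Hb₀⟩ := exists_Icc_left hab (hb₁.and (nhdsWithin_le_nhds
    (eventually_dirComp_nonpos hz (hB.dirComp_neg_of_corner hzb hBC (by linarith)))))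
  obtain ⟨b₁, hb₁', Hb₁⟩ := exists_Icc_right hbc (hb₂.and (nhdsWithin_le_nhds
    (eventually_dirComp_nonneg hz (hB.dirComp_pos_of_corner hzb hAB (by linarith)))))
  obtain ⟨c₁, hc₁, Hc⟩ := exists_Icc_left hbc (hac₂.and (nhdsWithin_le_nhds
    (eventually_dirComp_nonneg hz (hC.dirComp_pos_of_corner hzc hBC (by linarith)))))
  set R := cornerlessRect a b c with hR
  have hconv := convex_cornerlessRect a b c
  -- On each side one of the two terms vanishes, so the secant has a constant direction: `A + π` for
  -- `s = a`, `B + π` for `s = b`, `B` for `t = b`, `C` for `t = c`. At the corners both terms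
  -- vanish, which is why they are removed.
  have ea : ∀ t, secant z φ (a, t) = φ t * -z a := fun t => by simp [secant, ha0]
  have eb : ∀ t, secant z φ (b, t) = φ t * -z b := fun t => by simp [secant, hb0]
  have eb' : ∀ s, secant z φ (s, b) = φ s * z b := fun t => by simp [secant, hb0]
  have ec : ∀ s, secant z φ (s, c) = φ s * z c := fun t => by simp [secant, hc0]
  have hD0 : ∀ q ∈ R, secant z φ q ≠ 0 := by
    rintro ⟨s, t⟩ ⟨⟨p1, p2⟩, ⟨p3, p4⟩, p5, p6, p7, p8⟩
    dsimp only at *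
    have nz : ∀ {r : ℝ} {w : ℂ}, 0 < r → w ≠ 0 → (r : ℂ) * w ≠ 0 := fun hr hw =>
      mul_ne_zero (by exact_mod_cast hr.ne') hw
    rcases p1.eq_or_lt with rfl | p1
    · rw [ea]
      exact nz (hpos₂ t ⟨by linarith, by linarith⟩) (neg_ne_zero.2 hza)
    rcases p2.eq_or_lt with rfl | p2
    · rw [eb]
      exact nz (hpos₂ t ⟨by linarith, by linarith⟩) (neg_ne_zero.2 hzb)
    rcases p3.eq_or_lt with rfl | p3
    · rw [eb']
      exact nz (hpos₁ s ⟨p1, p2⟩) hzb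
    rcases p4.eq_or_lt with rfl | p4
    · rw [ec]
      exact nz (hpos₁ s ⟨p1, p2⟩) hzc
    exact hne s ⟨p1, p2⟩ t ⟨p3, p4⟩
  have mem_a : ∀ {t}, t ∈ Ioo b c → (a, t) ∈ R := fun {t} h => by
    refine ⟨⟨?_, ?_⟩, ⟨?_, ?_⟩, ?_, ?_, ?_, ?_⟩ <;> dsimp only <;> linarith [h.1, h.2]
  have mem_b : ∀ {t}, t ∈ Ioo b c → (b, t) ∈ R := fun {t} h => by
    refine ⟨⟨?_, ?_⟩, ⟨?_, ?_⟩, ?_, ?_, ?_, ?_⟩ <;> dsimp only <;> linarith [h.1, h.2]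
  have mem_b' : ∀ {s}, s ∈ Ioo a b → (s, b) ∈ R := fun {t} h => by
    refine ⟨⟨?_, ?_⟩, ⟨?_, ?_⟩, ?_, ?_, ?_, ?_⟩ <;> dsimp only <;> linarith [h.1, h.2]
  have mem_c : ∀ {s}, s ∈ Ioo a b → (s, c) ∈ R := fun {t} h => by
    refine ⟨⟨?_, ?_⟩, ⟨?_, ?_⟩, ?_, ?_, ?_, ?_⟩ <;> dsimp only <;> linarith [h.1, h.2]
  obtain ⟨θ, hθ, hang, hθa⟩ := exists_continuousOn_angle hconv
    (continuous_secant hz hφ).continuousOn hD0 (mem_a hc₁) (θ₀ := A + Real.pi) (by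
      rw [ea]; exact hA.add_pi.real_mul (hφ0 _))
  have edge : ∀ {p q : ℝ × ℝ} {α : ℝ}, p ∈ R → q ∈ R →
      (∀ x ∈ segment ℝ p q, IsAngle α (secant z φ x)) → θ p = α → θ q = α := by
    intro p q α hp hq h h'
    exact angle_eq_of_isAngle hθ hang hD0 (hconv.segment_subset hp hq)
      (convex_segment p q).isPreconnected h (left_mem_segment ℝ p q) (right_mem_segment ℝ p q) h'
  have edge_v : ∀ {x t₁ t₂ α : ℝ}, (x, t₁) ∈ R → (x, t₂) ∈ R →
      (∀ t, IsAngle α (secant z φ (x, t))) → θ (x, t₁) = α → θ (x, t₂) = α := by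
    intro x t₁ t₂ α hp hq h h'
    refine edge hp hq (fun y hy => ?_) h'
    have h1 := (Prod.segment_subset (𝕜 := ℝ) _ _ hy).1
    simp only [segment_same, mem_singleton_iff] at h1
    rw [show y = (x, y.2) from Prod.ext h1 rfl]
    exact h _
  have edge_h : ∀ {x t₁ t₂ α : ℝ}, (t₁, x) ∈ R → (t₂, x) ∈ R →
      (∀ t, IsAngle α (secant z φ (t, x))) → θ (t₁, x) = α → θ (t₂, x) = α := by
    intro x t₁ t₂ α hp hq h h'
    refine edge hp hq (fun y hy => ?_) h'
    have h1 := (Prod.segment_subset (𝕜 := ℝ) _ _ hy).2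
    simp only [segment_same, mem_singleton_iff] at h1
    rw [show y = (y.1, x) from Prod.ext rfl h1]
    exact h _
  have corner : ∀ {p q : ℝ × ℝ} (α : ℝ), p ∈ R → q ∈ R →
      (∀ s ∈ uIcc p.1 q.1, dirComp α (z s) ≤ 0) → (∀ t ∈ uIcc p.2 q.2, 0 ≤ dirComp α (z t)) →
      |θ p - α| ≤ Real.pi / 2 → |θ q - α| ≤ Real.pi / 2 := by
    intro p q α hp hq h1 h2 h
    exact abs_angle_sub_le hθ hang hD0 (hconv.segment_subset hp hq)
      (convex_segment p q).isPreconnected (dirComp_secant_nonneg hφ0 h1 h2)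
      (left_mem_segment ℝ p q) (right_mem_segment ℝ p q) h
  -- the corner `(a, c)`
  have h1 : θ (a₁, c) = C := by
    have := corner ((A + C) / 2 + Real.pi / 2) (mem_a hc₁) (mem_c ha₁)
      (fun s hs => (Ha s (by rwa [uIcc_of_le ha₁.1.le] at hs)).1)
      (fun s hs => (Hc s (by rwa [uIcc_of_le hc₁.2.le] at hs)).1)
      (by rw [hθa, abs_le]; constructor <;> linarith)
    refine (hang _ (mem_c ha₁)).eq_of_abs_lt (η := C) ?_ (hD0 _ (mem_c ha₁)) ?_
    · rw [ec]; exact hC.real_mul (hφ0 _)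
    · rw [abs_le] at this; rw [abs_lt]; constructor <;> linarith
  have h2 : θ (b₀, c) = C :=
    edge_h (mem_c ha₁) (mem_c hb₀) (fun t => by rw [ec]; exact hC.real_mul (hφ0 _)) h1
  -- The corner `(b, c)`.
  have h3 : θ (b, c₁) = B + Real.pi := by
    have := corner ((B + C) / 2 + Real.pi / 2) (mem_c hb₀) (mem_b hc₁)
      (fun s hs => (Hb₀ s (by rwa [uIcc_of_le hb₀.2.le] at hs)).2)
      (fun s hs => (Hc s (by rwa [uIcc_of_ge hc₁.2.le] at hs)).2)
      (by rw [h2, abs_le]; constructor <;> linarith)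
    refine (hang _ (mem_b hc₁)).eq_of_abs_lt (η := B + Real.pi) ?_ (hD0 _ (mem_b hc₁)) ?_
    · rw [eb]; exact hB.add_pi.real_mul (hφ0 _)
    · rw [abs_le] at this; rw [abs_lt]; constructor <;> linarith
  have h4 : θ (b, b₁) = B + Real.pi :=
    edge_v (mem_b hc₁) (mem_b hb₁') (fun t => by rw [eb]; exact hB.add_pi.real_mul (hφ0 _)) h3
  have h5 : θ (a, b₁) = A + Real.pi :=
    edge_v (mem_a hc₁) (mem_a hb₁') (fun t => by rw [ea]; exact hA.add_pi.real_mul (hφ0 _)) hθa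
  -- The corner `(a, b)`, reached from the starting point along the side `s = a`.
  have h6 : θ (a₁, b) = B := by
    have := corner ((A + B) / 2 + Real.pi / 2) (mem_a hb₁') (mem_b' ha₁)
      (fun s hs => (Ha s (by rwa [uIcc_of_le ha₁.1.le] at hs)).2)
      (fun s hs => (Hb₁ s (by rwa [uIcc_of_ge hb₁'.1.le] at hs)).2)
      (by rw [h5, abs_le]; constructor <;> linarith)
    refine (hang _ (mem_b' ha₁)).eq_of_abs_lt (η := B) ?_ (hD0 _ (mem_b' ha₁)) ?_
    · rw [eb']; exact hB.real_mul (hφ0 _)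
    · rw [abs_le] at this; rw [abs_lt]; constructor <;> linarith
  have h7 : θ (b₀, b) = B :=
    edge_h (mem_b' ha₁) (mem_b' hb₀) (fun t => by rw [eb']; exact hB.real_mul (hφ0 _)) h6
  -- At the last corner `(b, b)` a clockwise passage confines the angle to `[B - π, B]`, whereas the
  -- other way around the rectangle produced `B + π`.
  have h8 := corner (B - Real.pi / 2) (mem_b' hb₀) (mem_b hb₁')
      (fun s hs => (Hb₀ s (by rwa [uIcc_of_le hb₀.2.le] at hs)).1)
      (fun s hs => (Hb₁ s (by rwa [uIcc_of_le hb₁'.1.le] at hs)).1)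
      (by rw [h7, abs_le]; constructor <;> linarith)
  rw [h4, abs_le] at h8
  linarith

/-! ### Curves in the closed upper hemisphere -/

/-- A simple closed regular `C²` curve of period `P` in the closed upper hemisphere of the sphere,
in coordinates: `f` is the height and `z` the horizontal part; first and second derivatives are
recorded. -/
structure HemisphereCurve (P : ℝ) where
  z : ℝ → ℂ
  dz : ℝ → ℂ
  ddz : ℝ → ℂ
  f : ℝ → ℝ
  df : ℝ → ℝ
  ddf : ℝ → ℝ
  pos : 0 < P
  hz : ∀ t, HasDerivAt z (dz t) t
  hdz : ∀ t, HasDerivAt dz (ddz t) t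
  hf : ∀ t, HasDerivAt f (df t) t
  hdf : ∀ t, HasDerivAt df (ddf t) t
  cz : Continuous ddz
  cf : Continuous ddf
  nonneg : ∀ t, 0 ≤ f t
  norm_eq : ∀ t, (z t).re ^ 2 + (z t).im ^ 2 + f t ^ 2 = 1
  per_z : ∀ t, z (t + P) = z t
  per_f : ∀ t, f (t + P) = f t
  inj : ∀ s t, s < t → t < s + P → z s = z t → f s ≠ f t
  reg : ∀ t, dz t = 0 → df t ≠ 0

namespace HemisphereCurve

variable {P : ℝ} (c : HemisphereCurve P)

/-- The determinant of position, velocity and acceleration; it has the sign of the geodesic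
curvature. -/
def curv (t : ℝ) : ℝ :=
  c.f t * ((c.dz t).re * (c.ddz t).im - (c.ddz t).re * (c.dz t).im)
    - c.df t * ((c.z t).re * (c.ddz t).im - (c.ddz t).re * (c.z t).im)
    + c.ddf t * ((c.z t).re * (c.dz t).im - (c.dz t).re * (c.z t).im)

/-- The angular momentum of the horizontal part. -/
def spin (t : ℝ) : ℝ := (c.z t).re * (c.dz t).im - (c.dz t).re * (c.z t).im

/-- The mirror image. -/
def conj : HemisphereCurve P where
  z t := (starRingEnd ℂ) (c.z t)
  dz t := (starRingEnd ℂ) (c.dz t)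
  ddz t := (starRingEnd ℂ) (c.ddz t)
  f := c.f
  df := c.df
  ddf := c.ddf
  pos := c.pos
  hz t := (c.hz t).star
  hdz t := (c.hdz t).star
  hf := c.hf
  hdf := c.hdf
  cz := Complex.continuous_conj.comp c.cz
  cf := c.cf
  nonneg := c.nonneg
  norm_eq t := by simpa using c.norm_eq t
  per_z t := by rw [c.per_z]
  per_f := c.per_f
  inj s t h1 h2 h3 := c.inj s t h1 h2 ((starRingEnd ℂ).injective h3)
  reg t h := c.reg t (by simpa using h)

/-- The mirror image of the curve traversed backwards. -/
def reverse : HemisphereCurve P where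
  z t := (starRingEnd ℂ) (c.z (-t))
  dz t := -(starRingEnd ℂ) (c.dz (-t))
  ddz t := (starRingEnd ℂ) (c.ddz (-t))
  f t := c.f (-t)
  df t := -c.df (-t)
  ddf t := c.ddf (-t)
  pos := c.pos
  hz t := by
    have := ((c.hz (-t)).scomp t (hasDerivAt_neg t)).star
    simpa using this
  hdz t := by
    have := ((c.hdz (-t)).scomp t (hasDerivAt_neg t)).star.fun_neg
    simpa using this
  hf t := by
    have := (c.hf (-t)).comp t (hasDerivAt_neg t)
    rwa [mul_neg_one] at this
  hdf t := by
    have := ((c.hdf (-t)).comp t (hasDerivAt_neg t)).fun_neg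
    rwa [mul_neg_one, neg_neg] at this
  cz := Complex.continuous_conj.comp (c.cz.comp continuous_neg)
  cf := c.cf.comp continuous_neg
  nonneg t := c.nonneg (-t)
  norm_eq t := by simpa using c.norm_eq (-t)
  per_z t := by rw [← c.per_z (-(t + P))]; congr 2; ring
  per_f t := by rw [← c.per_f (-(t + P))]; congr 1; ring
  inj s t h1 h2 h3 h4 := c.inj (-t) (-s) (by linarith) (by linarith)
    ((starRingEnd ℂ).injective h3).symm h4.symm
  reg t h := by
    have := c.reg (-t) (by simpa using h)
    simpa using this

@[simp] theorem conj_z (t : ℝ) : c.conj.z t = (starRingEnd ℂ) (c.z t) := rfl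
@[simp] theorem reverse_f (t : ℝ) : c.reverse.f t = c.f (-t) := rfl
@[simp] theorem reverse_z (t : ℝ) : c.reverse.z t = (starRingEnd ℂ) (c.z (-t)) := rfl

theorem conj_curv (t : ℝ) : c.conj.curv t = -c.curv t := by
  simp [curv, conj]; ring

theorem conj_spin (t : ℝ) : c.conj.spin t = -c.spin t := by
  simp [spin, conj]; ring

theorem reverse_curv (t : ℝ) : c.reverse.curv t = c.curv (-t) := by
  simp [curv, reverse]; ring

theorem reverse_spin (t : ℝ) : c.reverse.spin t = c.spin (-t) := by
  simp [spin, reverse]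

theorem continuous_z : Continuous c.z := continuous_iff_continuousAt.2 fun t => (c.hz t).continuousAt
theorem continuous_dz : Continuous c.dz :=
  continuous_iff_continuousAt.2 fun t => (c.hdz t).continuousAt
theorem continuous_f : Continuous c.f := continuous_iff_continuousAt.2 fun t => (c.hf t).continuousAt
theorem continuous_df : Continuous c.df :=
  continuous_iff_continuousAt.2 fun t => (c.hdf t).continuousAt

theorem continuous_curv : Continuous c.curv := by
  have := c.continuous_z
  have := c.continuous_dz
  have := c.continuous_f
  have := c.continuous_df
  have := c.cz
  have := c.cf
  unfold curv; fun_prop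

theorem per_dz (t : ℝ) : c.dz (t + P) = c.dz t := by
  have h1 := (c.hz (t + P)).comp_add_const t P
  have : (fun x => c.z (x + P)) = c.z := funext c.per_z
  rw [this] at h1
  exact h1.unique (c.hz t)

theorem spin_add_period (t : ℝ) : c.spin (t + P) = c.spin t := by
  rw [spin, spin, c.per_dz, c.per_z]

theorem hasDerivAt_re (t : ℝ) : HasDerivAt (fun t => (c.z t).re) (c.dz t).re t :=
  Complex.reCLM.hasFDerivAt.comp_hasDerivAt t (c.hz t)

theorem hasDerivAt_im (t : ℝ) : HasDerivAt (fun t => (c.z t).im) (c.dz t).im t :=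
  Complex.imCLM.hasFDerivAt.comp_hasDerivAt t (c.hz t)

theorem hasDerivAt_dre (t : ℝ) : HasDerivAt (fun t => (c.dz t).re) (c.ddz t).re t :=
  Complex.reCLM.hasFDerivAt.comp_hasDerivAt t (c.hdz t)

theorem hasDerivAt_dim (t : ℝ) : HasDerivAt (fun t => (c.dz t).im) (c.ddz t).im t :=
  Complex.imCLM.hasFDerivAt.comp_hasDerivAt t (c.hdz t)

theorem tangency (t : ℝ) :
    (c.z t).re * (c.dz t).re + (c.z t).im * (c.dz t).im + c.f t * c.df t = 0 := by
  have h := (((c.hasDerivAt_re t).pow 2).add ((c.hasDerivAt_im t).pow 2)).add ((c.hf t).pow 2)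
  have h2 : HasDerivAt (fun _ : ℝ => (1 : ℝ)) 0 t := hasDerivAt_const _ _
  have := h.unique (h2.congr_of_eventuallyEq (Eventually.of_forall fun s => c.norm_eq s))
  simp at this
  linarith

variable {c}

theorem df_eq_zero {t : ℝ} (h : c.f t = 0) : c.df t = 0 :=
  IsLocalMin.hasDerivAt_eq_zero (Eventually.of_forall fun s => by rw [h]; exact c.nonneg s) (c.hf t)

/-- At a contact `f` is minimal, so the velocity is horizontal. It is also orthogonal to the
position, hence tangent to the equator, and it is nonzero by regularity. -/
theorem spin_ne_zero {t : ℝ} (h : c.f t = 0) : c.spin t ≠ 0 := by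
  intro h0
  have hd := df_eq_zero h
  have h1 := c.tangency t
  have h2 := c.norm_eq t
  rw [h] at h1 h2
  rw [spin] at h0
  have h3 : (c.dz t).re ^ 2 + (c.dz t).im ^ 2 = 0 := by
    have : ((c.dz t).re ^ 2 + (c.dz t).im ^ 2) * ((c.z t).re ^ 2 + (c.z t).im ^ 2) =
      ((c.z t).re * (c.dz t).re + (c.z t).im * (c.dz t).im) ^ 2 +
      ((c.z t).re * (c.dz t).im - (c.dz t).re * (c.z t).im) ^ 2 := by ring
    rw [h0] at this
    nlinarith
  refine c.reg t (Complex.ext ?_ ?_) hd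
  · simp; nlinarith [sq_nonneg (c.dz t).re, sq_nonneg (c.dz t).im]
  · simp; nlinarith [sq_nonneg (c.dz t).re, sq_nonneg (c.dz t).im]

theorem norm_z {t : ℝ} (h : c.f t = 0) : ‖c.z t‖ = 1 := by
  have h2 := c.norm_eq t
  rw [h] at h2
  rw [← abs_norm, ← abs_one, ← sq_eq_sq_iff_abs_eq_abs, ← Complex.normSq_eq_norm_sq,
    Complex.normSq_apply]
  linarith

theorem z_ne_zero {t : ℝ} (h : c.f t = 0) : c.z t ≠ 0 := by
  rw [← norm_ne_zero_iff, norm_z h]; exact one_ne_zero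

theorem isAngle_unique {θ : ℝ} {s t : ℝ} (hs : c.f s = 0) (ht : c.f t = 0)
    (h1 : IsAngle θ (c.z s)) (h2 : IsAngle θ (c.z t)) : c.z s = c.z t := by
  rw [IsAngle, norm_z hs] at h1
  rw [IsAngle, norm_z ht] at h2
  rw [h1, h2]

end HemisphereCurve

/-! ### Order and direction of the contacts -/

theorem eventually_sign_of_hasDerivAt {g : ℝ → ℝ} {g' b : ℝ} (h : HasDerivAt g g' b)
    (h0 : g b = 0) (hpos : 0 < g') :
    (∀ᶠ s in 𝓝[≤] b, g s ≤ 0) ∧ ∀ᶠ s in 𝓝[≥] b, 0 ≤ g s := by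
  have h1 := (hasDerivAt_iff_tendsto_slope.1 h).eventually_const_lt hpos
  rw [eventually_nhdsWithin_iff] at h1
  constructor
  · filter_upwards [nhdsWithin_le_nhds h1, self_mem_nhdsWithin] with s hs hsb
    rcases eq_or_ne s b with rfl | hne
    · exact h0.le
    have := hs hne
    rw [slope_def_field, h0, sub_zero] at this
    have hlt : s - b < 0 := sub_neg.2 (lt_of_le_of_ne hsb hne)
    by_contra! hc
    exact absurd this (not_lt.2 (div_nonpos_of_nonneg_of_nonpos hc.le hlt.le))
  · filter_upwards [nhdsWithin_le_nhds h1, self_mem_nhdsWithin] with s hs hsb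
    rcases eq_or_ne s b with rfl | hne
    · exact h0.ge
    have := hs hne
    rw [slope_def_field, h0, sub_zero] at this
    have hlt : 0 < s - b := sub_pos.2 (lt_of_le_of_ne hsb hne.symm)
    by_contra! hc
    exact absurd this (not_lt.2 (div_nonpos_of_nonpos_of_nonneg hc.le hlt.le))

/-- A nonnegative positively homogeneous function, vanishing only in the direction `A`. -/
def gauge (A : ℝ) (w : ℂ) : ℝ := ‖w‖ - dirComp A w

theorem gauge_smul (A r : ℝ) (hr : 0 ≤ r) (w : ℂ) : gauge A (r * w) = r * gauge A w := by
  rw [gauge, gauge, dirComp_smul, norm_mul, Complex.norm_real, Real.norm_of_nonneg hr]; ring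

theorem sq_dirComp_add_sq (A : ℝ) (w : ℂ) :
    dirComp A w ^ 2 + dirComp (A + Real.pi / 2) w ^ 2 = ‖w‖ ^ 2 := by
  rw [← Complex.normSq_eq_norm_sq, Complex.normSq_apply, dirComp, dirComp, Real.cos_add_pi_div_two,
    Real.sin_add_pi_div_two]
  linear_combination (w.re ^ 2 + w.im ^ 2) * Real.sin_sq_add_cos_sq A

theorem gauge_nonneg (A : ℝ) (w : ℂ) : 0 ≤ gauge A w := by
  have := sq_dirComp_add_sq A w
  rw [gauge, sub_nonneg]
  exact le_of_sq_le_sq (by nlinarith [sq_nonneg (dirComp (A + Real.pi / 2) w)]) (norm_nonneg _)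

theorem gauge_eq_zero_iff (A : ℝ) (w : ℂ) : gauge A w = 0 ↔ IsAngle A w := by
  constructor
  · intro h
    have h1 := sq_dirComp_add_sq A w
    have h2 : dirComp A w = ‖w‖ := by rw [gauge] at h; linarith
    have h3 : dirComp (A + Real.pi / 2) w = 0 := by
      rw [h2] at h1
      exact pow_eq_zero_iff (two_ne_zero) |>.1 (by linarith)
    rw [dirComp, Real.cos_add_pi_div_two, Real.sin_add_pi_div_two] at h3
    rw [dirComp] at h2
    have h4 := Real.sin_sq_add_cos_sq A
    apply Complex.ext
    · rw [Complex.re_ofReal_mul, Complex.exp_ofReal_mul_I_re]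
      linear_combination Real.cos A * h2 - Real.sin A * h3 - w.re * h4
    · rw [Complex.im_ofReal_mul, Complex.exp_ofReal_mul_I_im]
      linear_combination Real.sin A * h2 + Real.cos A * h3 - w.im * h4
  · intro h
    rw [gauge, h.dirComp]; simp

theorem continuous_gauge (A : ℝ) : Continuous (gauge A) := by
  have := continuous_dirComp A
  unfold gauge; fun_prop

namespace HemisphereCurve

variable {P : ℝ} {c : HemisphereCurve P}

theorem hasDerivAt_dirComp (c : HemisphereCurve P) (α t : ℝ) :
    HasDerivAt (fun t => dirComp α (c.z t)) (dirComp α (c.dz t)) t :=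
  ((c.hasDerivAt_re t).const_mul _).add ((c.hasDerivAt_im t).const_mul _)

theorem dirComp_sub_pi_div_two {t B : ℝ} (hB : IsAngle B (c.z t)) (h : c.f t = 0) (w : ℂ) :
    dirComp (B - Real.pi / 2) w = (c.z t).im * w.re - (c.z t).re * w.im := by
  rw [dirComp, Real.cos_sub_pi_div_two, Real.sin_sub_pi_div_two, hB.re, hB.im, norm_z h]; ring

/-- Other contacts may lie between the given ones, so `f` cannot serve as the weight of the secant
vectors. A multiple-preserving correction in `z` lifts the curve off the equator except in the three
chosen directions. -/
theorem spin_pos_of_corner {a b d : ℝ} (hab : a < b) (hbd : b < d) (hd : d ≤ a + P)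
    (ha0 : c.f a = 0) (hb0 : c.f b = 0) (hd0 : c.f d = 0) {A B C : ℝ}
    (hA : IsAngle A (c.z a)) (hB : IsAngle B (c.z b)) (hC : IsAngle C (c.z d))
    (hAB : A < B) (hBC : B < C) (hCA : C ≤ A + 2 * Real.pi)
    (hac₁ : ∀ᶠ s in 𝓝[≥] a, dirComp ((A + C) / 2 + Real.pi / 2) (c.z s) ≤ 0)
    (hac₂ : ∀ᶠ s in 𝓝[≤] d, 0 ≤ dirComp ((A + C) / 2 + Real.pi / 2) (c.z s)) :
    0 < c.spin b := by
  by_contra hcw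
  have hcw : c.spin b < 0 := lt_of_le_of_ne (not_lt.1 hcw) (spin_ne_zero hb0)
  -- Positive homogeneity of `m` is essential: if `z t = r * z s`, then proportional values of `f +
  -- m` force proportional values of `f`.
  let m : ℂ → ℝ := fun w => min (gauge A w) (min (gauge B w) (gauge C w))
  have hm0 : ∀ w, 0 ≤ m w := fun w =>
    le_min (gauge_nonneg _ _) (le_min (gauge_nonneg _ _) (gauge_nonneg _ _))
  have hmc : Continuous m :=
    (continuous_gauge A).min ((continuous_gauge B).min (continuous_gauge C))
  have hms : ∀ (r : ℝ) (w : ℂ), 0 ≤ r → m (r * w) = r * m w := fun r w hr => by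
    simp only [m, gauge_smul _ _ hr, mul_min_of_nonneg _ _ hr]
  have hmz : ∀ w, m w = 0 → IsAngle A w ∨ IsAngle B w ∨ IsAngle C w := by
    intro w hw
    simp only [← gauge_eq_zero_iff]
    rcases min_choice (gauge A w) (min (gauge B w) (gauge C w)) with h | h
    · left; rw [← h]; exact hw
    rcases min_choice (gauge B w) (gauge C w) with h' | h'
    · right; left; rw [← h', ← h]; exact hw
    · right; right; rw [← h', ← h]; exact hw
  let φ : ℝ → ℝ := fun t => c.f t + m (c.z t)
  have hφc : Continuous φ := c.continuous_f.add (hmc.comp c.continuous_z)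
  have hφ0 : ∀ t, 0 ≤ φ t := fun t => add_nonneg (c.nonneg t) (hm0 _)
  have hmA : m (c.z a) = 0 := le_antisymm
    (by simp only [m]; rw [(gauge_eq_zero_iff A (c.z a)).2 hA]; exact min_le_left _ _) (hm0 _)
  have hmB : m (c.z b) = 0 := le_antisymm
    (by
      simp only [m]; rw [(gauge_eq_zero_iff B (c.z b)).2 hB]
      exact (min_le_right _ _).trans (min_le_left _ _)) (hm0 _)
  have hmC : m (c.z d) = 0 := le_antisymm
    (by
      simp only [m]; rw [(gauge_eq_zero_iff C (c.z d)).2 hC]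
      exact (min_le_right _ _).trans (min_le_right _ _)) (hm0 _)
  -- A zero of `φ` is a contact in one of the three directions, so by simplicity it is one of the
  -- three given contacts.
  have hpos : ∀ s ∈ Ioo a d, s ≠ b → 0 < φ s := by
    intro s hs hsb
    refine lt_of_le_of_ne (hφ0 s) fun h => ?_
    have hf0 : c.f s = 0 := by have := c.nonneg s; have := hm0 (c.z s); simp only [φ] at h; linarith
    have hm : m (c.z s) = 0 := by simp only [φ, hf0] at h; linarith
    rcases hmz _ hm with h1 | h1 | h1
    · exact c.inj a s hs.1 (by linarith [hs.2]) (isAngle_unique ha0 hf0 hA h1) (ha0.trans hf0.symm)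
    · rcases lt_or_gt_of_ne hsb with h2 | h2
      · exact c.inj s b h2 (by linarith [hs.1]) (isAngle_unique hf0 hb0 h1 hB) (hf0.trans hb0.symm)
      · exact c.inj b s h2 (by linarith [hs.2]) (isAngle_unique hb0 hf0 hB h1) (hb0.trans hf0.symm)
    · exact c.inj s d hs.2 (by linarith [hs.1]) (isAngle_unique hf0 hd0 h1 hC) (hf0.trans hd0.symm)
  have hsign := eventually_sign_of_hasDerivAt (c.hasDerivAt_dirComp (B - Real.pi / 2) b)
    (by rw [dirComp_sub_pi_div_two hB hb0]; ring)
    (by rw [dirComp_sub_pi_div_two hB hb0]; rw [spin] at hcw; linarith)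
  refine not_clockwise_of_ordered c.continuous_z hφc hφ0 hab hbd (by simp [φ, ha0, hmA])
    (by simp [φ, hb0, hmB]) (by simp [φ, hd0, hmC])
    (fun s hs => hpos s ⟨hs.1, hs.2.trans hbd⟩ hs.2.ne)
    (fun s hs => hpos s ⟨hab.trans hs.1, hs.2⟩ hs.1.ne') ?_
    (z_ne_zero ha0) (z_ne_zero hb0) (z_ne_zero hd0) hA hB hC hAB hBC hCA hac₁ hac₂ hsign.1 hsign.2
  -- A vanishing secant makes the two points of the sphere positive multiples of each other, hence
  -- equal, against simplicity.
  intro s hs t ht h0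
  have hs0 := hpos s ⟨hs.1, hs.2.trans hbd⟩ hs.2.ne
  have ht0 := hpos t ⟨hab.trans ht.1, ht.2⟩ ht.1.ne'
  obtain ⟨r, hr⟩ : ∃ r, r = φ t / φ s := ⟨_, rfl⟩
  have hr0 : 0 < r := by rw [hr]; positivity
  have hrφ : φ t = r * φ s := by rw [hr]; field_simp
  have hzr : c.z t = r * c.z s := by
    have h1 : (φ s : ℂ) ≠ 0 := by exact_mod_cast hs0.ne'
    apply mul_left_cancel₀ h1
    rw [secant, sub_eq_zero] at h0
    rw [h0, hrφ]; push_cast; ring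
  have hfr : c.f t = r * c.f s := by
    have : c.f t + m (c.z t) = r * (c.f s + m (c.z s)) := hrφ
    rw [hzr, hms _ _ hr0.le] at this; linarith
  have hr1 : r = 1 := by
    have h1 := c.norm_eq t
    have h2 := c.norm_eq s
    rw [hzr, hfr, Complex.re_ofReal_mul, Complex.im_ofReal_mul] at h1
    have h3 : r ^ 2 = 1 := by linear_combination h1 - r ^ 2 * h2
    nlinarith
  rw [hr1] at hzr hfr
  exact c.inj s t (hs.2.trans ht.1) (by linarith [hs.1, ht.2]) (by simpa using hzr.symm)
    (by simpa using hfr.symm)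

/-- If three contacts with the equator are passed in counterclockwise order, then the curve moves
counterclockwise at the second one. -/
theorem spin_pos_of_ordered {a b d : ℝ} (hab : a < b) (hbd : b < d) (hd : d ≤ a + P)
    (ha0 : c.f a = 0) (hb0 : c.f b = 0) (hd0 : c.f d = 0) {A B C : ℝ}
    (hA : IsAngle A (c.z a)) (hB : IsAngle B (c.z b)) (hC : IsAngle C (c.z d))
    (hAB : A < B) (hBC : B < C) (hCA : C < A + 2 * Real.pi) : 0 < c.spin b :=
  spin_pos_of_corner hab hbd hd ha0 hb0 hd0 hA hB hC hAB hBC hCA.le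
    (nhdsWithin_le_nhds (eventually_dirComp_nonpos c.continuous_z
      (hA.dirComp_neg_of_corner (z_ne_zero ha0) (by linarith) hCA)))
    (nhdsWithin_le_nhds (eventually_dirComp_nonneg c.continuous_z
      (hC.dirComp_pos_of_corner (z_ne_zero hd0) (by linarith) hCA)))

/-- The direction of motion is the same at any two contacts with the equator. -/
theorem spin_pos_of_spin_pos {a b : ℝ} (hab : a < b) (hb : b < a + P)
    (ha0 : c.f a = 0) (hb0 : c.f b = 0) {A B : ℝ}
    (hA : IsAngle A (c.z a)) (hB : IsAngle B (c.z b)) (hAB : A < B) (hBA : B < A + 2 * Real.pi)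
    (hccw : 0 < c.spin a) : 0 < c.spin b := by
  have hA' : IsAngle (A + 2 * Real.pi) (c.z (a + P)) := by
    have := hA.add_pi.add_pi
    rw [neg_neg] at this
    rw [c.per_z]; convert this using 1; ring
  -- When the third contact is the first one a period later, the separating line passes through `z
  -- a` itself. The half-plane conditions then no longer follow from position; they come from the
  -- counterclockwise velocity at `a`.
  have key : ∀ w, dirComp ((A + (A + 2 * Real.pi)) / 2 + Real.pi / 2) w =
      (c.z a).im * w.re - (c.z a).re * w.im := by
    intro w
    rw [← dirComp_sub_pi_div_two hA ha0, dirComp, dirComp,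
      show (A + (A + 2 * Real.pi)) / 2 + Real.pi / 2 = (A - Real.pi / 2) + 2 * Real.pi by ring,
      Real.cos_add_two_pi, Real.sin_add_two_pi]
  have hder := c.hasDerivAt_dirComp ((A + (A + 2 * Real.pi)) / 2 + Real.pi / 2)
  have h1 := eventually_sign_of_hasDerivAt (hder a).neg (by rw [Pi.neg_apply, key]; ring)
    (by rw [key]; rw [spin] at hccw; linarith)
  have h2 := eventually_sign_of_hasDerivAt (hder (a + P)).neg
    (by rw [Pi.neg_apply, key, c.per_z]; ring)
    (by rw [key, c.per_dz]; rw [spin] at hccw; linarith)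
  refine spin_pos_of_corner hab hb le_rfl ha0 hb0 (by rw [c.per_f, ha0]) hA hB hA' hAB
    hBA le_rfl (h1.2.mono fun s hs => ?_) (h2.1.mono fun s hs => ?_)
  · simpa using hs
  · simpa using hs

end HemisphereCurve

/-! ### Local convexity at a contact, in an affine chart -/

namespace HemisphereCurve

variable {P : ℝ} (c : HemisphereCurve P)

/-- The horizontal coordinate in direction `A`. -/
def co (A t : ℝ) : ℝ := dirComp A (c.z t)
/-- The first derivative of the horizontal coordinate in direction `A`. -/
def dco (A t : ℝ) : ℝ := dirComp A (c.dz t)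
/-- The second derivative of the horizontal coordinate in direction `A`. -/
def ddco (A t : ℝ) : ℝ := dirComp A (c.ddz t)

theorem hasDerivAt_co (A t : ℝ) : HasDerivAt (c.co A) (c.dco A t) t := c.hasDerivAt_dirComp A t

theorem hasDerivAt_dco (A t : ℝ) : HasDerivAt (c.dco A) (c.ddco A t) t :=
  ((c.hasDerivAt_dre t).const_mul _).add ((c.hasDerivAt_dim t).const_mul _)

theorem continuous_co (A : ℝ) : Continuous (c.co A) := (continuous_dirComp A).comp c.continuous_z

theorem dirComp_add_pi_div_two (A : ℝ) (w : ℂ) :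
    dirComp (A + Real.pi / 2) w = Real.cos A * w.im - Real.sin A * w.re := by
  rw [dirComp, Real.cos_add_pi_div_two, Real.sin_add_pi_div_two]; ring

theorem dirComp_add_pi (A : ℝ) (w : ℂ) : dirComp (A + Real.pi) w = -dirComp A w := by
  rw [dirComp, dirComp, Real.cos_add_pi, Real.sin_add_pi]; ring

theorem spin_eq (A t : ℝ) : c.spin t =
    c.co A t * c.dco (A + Real.pi / 2) t - c.dco A t * c.co (A + Real.pi / 2) t := by
  simp only [spin, co, dco, dirComp, Real.cos_add_pi_div_two, Real.sin_add_pi_div_two]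
  linear_combination (-((c.z t).re * (c.dz t).im - (c.dz t).re * (c.z t).im)) *
    Real.sin_sq_add_cos_sq A

theorem curv_eq (A t : ℝ) : c.curv t =
    c.f t * (c.dco A t * c.ddco (A + Real.pi / 2) t - c.ddco A t * c.dco (A + Real.pi / 2) t)
    - c.df t * (c.co A t * c.ddco (A + Real.pi / 2) t - c.ddco A t * c.co (A + Real.pi / 2) t)
    + c.ddf t * (c.co A t * c.dco (A + Real.pi / 2) t - c.dco A t * c.co (A + Real.pi / 2) t) := by
  have h := Real.sin_sq_add_cos_sq A
  simp only [curv, co, dco, ddco, dirComp, Real.cos_add_pi_div_two, Real.sin_add_pi_div_two]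
  linear_combination (-(c.f t * ((c.dz t).re * (c.ddz t).im - (c.ddz t).re * (c.dz t).im)
    - c.df t * ((c.z t).re * (c.ddz t).im - (c.ddz t).re * (c.z t).im)
    + c.ddf t * ((c.z t).re * (c.dz t).im - (c.dz t).re * (c.z t).im))) * h

theorem hasDerivAt_spin (A t : ℝ) : HasDerivAt c.spin
    (c.co A t * c.ddco (A + Real.pi / 2) t - c.ddco A t * c.co (A + Real.pi / 2) t) t := by
  have h1 := ((c.hasDerivAt_co A t).mul (c.hasDerivAt_dco (A + Real.pi / 2) t)).sub
    ((c.hasDerivAt_dco A t).mul (c.hasDerivAt_co (A + Real.pi / 2) t))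
  have h2 : c.spin = fun t =>
      c.co A t * c.dco (A + Real.pi / 2) t - c.dco A t * c.co (A + Real.pi / 2) t :=
    funext fun t => c.spin_eq A t
  rw [h2]
  refine h1.congr_deriv ?_
  ring

theorem continuous_spin : Continuous c.spin :=
  continuous_iff_continuousAt.2 fun t => (c.hasDerivAt_spin 0 t).continuousAt

/-- The slope of the curve in the affine chart centred at direction `A`. -/
def chartSlope (A t : ℝ) : ℝ := (c.df t * c.co A t - c.f t * c.dco A t) / c.spin t

/-- In the chart with abscissa `co (A + π/2) / co A` and height `f / co A`, the curve is a graph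
wherever `co A` and `spin` are positive. There the derivative of the slope has the sign of `curv`,
so positive curvature means convexity. -/
theorem hasDerivAt_chartSlope {A t : ℝ} (h : c.spin t ≠ 0) :
    HasDerivAt (c.chartSlope A) (c.co A t * c.curv t / c.spin t ^ 2) t := by
  have h1 := (((c.hdf t).mul (c.hasDerivAt_co A t)).sub
    ((c.hf t).mul (c.hasDerivAt_dco A t))).div (c.hasDerivAt_spin A t) h
  refine h1.congr_deriv ?_
  simp only [Pi.mul_apply, Pi.sub_apply]
  congr 1
  rw [c.curv_eq A, c.spin_eq A]
  ring

theorem hasDerivAt_chartHeight {A t : ℝ} (h : c.co A t ≠ 0) :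
    HasDerivAt (fun t => c.f t / c.co A t)
      ((c.df t * c.co A t - c.f t * c.dco A t) / c.co A t ^ 2) t :=
  (c.hf t).div (c.hasDerivAt_co A t) h

theorem hasDerivAt_chartAbscissa {A t : ℝ} (h : c.co A t ≠ 0) :
    HasDerivAt (fun t => c.co (A + Real.pi / 2) t / c.co A t) (c.spin t / c.co A t ^ 2) t := by
  refine ((c.hasDerivAt_co (A + Real.pi / 2) t).div (c.hasDerivAt_co A t) h).congr_deriv ?_
  rw [c.spin_eq A]; congr 1; ring

variable {c}

theorem isAngle_facts {a A : ℝ} (ha : c.f a = 0) (hA : IsAngle A (c.z a)) :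
    c.co A a = 1 ∧ c.co (A + Real.pi / 2) a = 0 := by
  constructor
  · rw [co, hA.dirComp, norm_z ha]; simp
  · rw [co, hA.dirComp, norm_z ha, show A - (A + Real.pi / 2) = -(Real.pi / 2) by ring]; simp

/-- Near a counterclockwise contact the chart is defined and the curve is a graph. -/
theorem exists_chart {a A e : ℝ} (hae : a < e) (ha : c.f a = 0) (hA : IsAngle A (c.z a))
    (hs : 0 < c.spin a) : ∃ d ∈ Ioo a e, ∀ t ∈ Icc a d, 0 < c.co A t ∧ 0 < c.spin t :=
  exists_Icc_right hae (nhdsWithin_le_nhds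
    (((c.continuous_co A).continuousAt.eventually_const_lt
      (by rw [(isAngle_facts ha hA).1]; exact one_pos)).and
      (c.continuous_spin.continuousAt.eventually_const_lt hs)))

theorem monotoneOn_Icc_of_hasDerivAt {g g' : ℝ → ℝ} {a d : ℝ}
    (h : ∀ t ∈ Icc a d, HasDerivAt g (g' t) t) (h' : ∀ t ∈ Ioo a d, 0 ≤ g' t) :
    MonotoneOn g (Icc a d) := by
  refine monotoneOn_of_hasDerivWithinAt_nonneg (f' := g') (convex_Icc a d)
    (fun t ht => (h t ht).continuousAt.continuousWithinAt) (fun t ht => ?_) fun t ht => ?_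
  · rw [interior_Icc] at ht
    exact (h t (Ioo_subset_Icc_self ht)).hasDerivWithinAt
  · rw [interior_Icc] at ht
    exact h' t ht

theorem strictMonoOn_Icc_of_hasDerivAt {g g' : ℝ → ℝ} {a d : ℝ}
    (h : ∀ t ∈ Icc a d, HasDerivAt g (g' t) t) (h' : ∀ t ∈ Ioo a d, 0 < g' t) :
    StrictMonoOn g (Icc a d) := by
  refine strictMonoOn_of_hasDerivWithinAt_pos (f' := g') (convex_Icc a d)
    (fun t ht => (h t ht).continuousAt.continuousWithinAt) (fun t ht => ?_) fun t ht => ?_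
  · rw [interior_Icc] at ht
    exact (h t (Ioo_subset_Icc_self ht)).hasDerivWithinAt
  · rw [interior_Icc] at ht
    exact h' t ht

theorem chartSlope_contact {a A : ℝ} (ha : c.f a = 0) : c.chartSlope A a = 0 := by
  rw [chartSlope, ha, df_eq_zero ha]; simp

/-- A curve with curvature of constant sign leaves the equator on the corresponding side. -/
theorem height_pos_of_curv_pos {a d A σ : ℝ} (ha : c.f a = 0)
    (hch : ∀ t ∈ Icc a d, 0 < c.co A t ∧ 0 < c.spin t)
    (hσ : ∀ t ∈ Ioo a d, 0 < σ * c.curv t) {t : ℝ} (ht : t ∈ Ioc a d) : 0 < σ * c.f t := by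
  have had : a ≤ d := ht.1.le.trans ht.2
  have hG : StrictMonoOn (fun t => σ * c.chartSlope A t) (Icc a d) :=
    strictMonoOn_Icc_of_hasDerivAt
      (fun t ht => (c.hasDerivAt_chartSlope (hch t ht).2.ne').const_mul σ) fun t ht => by
      have := hch t (Ioo_subset_Icc_self ht)
      have h2 := hσ t ht
      rw [show σ * (c.co A t * c.curv t / c.spin t ^ 2) =
        c.co A t / c.spin t ^ 2 * (σ * c.curv t) by ring]
      exact mul_pos (div_pos this.1 (pow_pos this.2 2)) h2
  have hF : StrictMonoOn (fun t => σ * (c.f t / c.co A t)) (Icc a d) :=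
    strictMonoOn_Icc_of_hasDerivAt
      (fun t ht => (c.hasDerivAt_chartHeight (hch t ht).1.ne').const_mul σ) fun t ht => by
      have h1 := hch t (Ioo_subset_Icc_self ht)
      have h2 := hG (left_mem_Icc.2 had) (Ioo_subset_Icc_self ht) ht.1
      simp only [chartSlope_contact ha, mul_zero] at h2
      have h3 : c.df t * c.co A t - c.f t * c.dco A t = c.spin t * c.chartSlope A t := by
        rw [chartSlope, mul_div_cancel₀ _ h1.2.ne']
      rw [h3, show σ * (c.spin t * c.chartSlope A t / c.co A t ^ 2) =
        c.spin t / c.co A t ^ 2 * (σ * c.chartSlope A t) by ring]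
      exact mul_pos (div_pos h1.2 (pow_pos h1.1 2)) h2
  have h1 := hF (left_mem_Icc.2 had) (Ioc_subset_Icc_self ht) ht.1
  simp only [ha, zero_div, mul_zero] at h1
  have h2 := (hch t (Ioc_subset_Icc_self ht)).1
  rw [← mul_div_assoc] at h1
  exact (div_pos_iff_of_pos_right h2).1 h1

/-- The secant vectors and the tangent vector `f z' - f' z` near a counterclockwise contact after
which the curvature is nonnegative. -/
theorem chart_inequalities {a d A : ℝ} (ha : c.f a = 0) (hA : IsAngle A (c.z a))
    (hch : ∀ t ∈ Icc a d, 0 < c.co A t ∧ 0 < c.spin t)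
    (hK : ∀ t ∈ Ioo a d, 0 ≤ c.curv t) :
    (∀ s ∈ Icc a d, ∀ t ∈ Icc a d, s ≤ t → c.f s * c.co A t - c.f t * c.co A s ≤ 0) ∧
    ∀ t ∈ Icc a d, c.f t * c.dco A t - c.df t * c.co A t ≤ 0 ∧
      c.f t * c.dco (A + Real.pi / 2) t - c.df t * c.co (A + Real.pi / 2) t ≤ 0 := by
  rcases lt_or_ge d a with had | had
  · rw [Icc_eq_empty (not_le.2 had)]; simp
  have hG : MonotoneOn (c.chartSlope A) (Icc a d) :=
    monotoneOn_Icc_of_hasDerivAt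
      (fun t ht => c.hasDerivAt_chartSlope (hch t ht).2.ne') fun t ht => by
      have h1 := hch t (Ioo_subset_Icc_self ht)
      have h2 := hK t ht
      exact div_nonneg (mul_nonneg h1.1.le h2) (sq_nonneg _)
  have hG0 : ∀ t ∈ Icc a d, 0 ≤ c.chartSlope A t := fun t ht => by
    rw [← chartSlope_contact (A := A) ha]; exact hG (left_mem_Icc.2 had) ht ht.1
  have hQ : ∀ t ∈ Icc a d, c.df t * c.co A t - c.f t * c.dco A t = c.spin t * c.chartSlope A t :=
    fun t ht => by rw [chartSlope, mul_div_cancel₀ _ (hch t ht).2.ne']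
  have hF : MonotoneOn (fun t => c.f t / c.co A t) (Icc a d) :=
    monotoneOn_Icc_of_hasDerivAt
      (fun t ht => c.hasDerivAt_chartHeight (hch t ht).1.ne') fun t ht => by
      have ht' := Ioo_subset_Icc_self ht
      rw [hQ t ht']
      exact div_nonneg (mul_nonneg (hch t ht').2.le (hG0 t ht')) (sq_nonneg _)
  have hY : MonotoneOn (fun t => c.co (A + Real.pi / 2) t / c.co A t) (Icc a d) :=
    monotoneOn_Icc_of_hasDerivAt
      (fun t ht => c.hasDerivAt_chartAbscissa (hch t ht).1.ne') fun t ht =>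
      div_nonneg (hch t (Ioo_subset_Icc_self ht)).2.le (sq_nonneg _)
  have hY0 : ∀ t ∈ Icc a d, 0 ≤ c.co (A + Real.pi / 2) t / c.co A t := fun t ht => by
    have := hY (left_mem_Icc.2 had) ht ht.1
    simpa [(isAngle_facts ha hA).2] using this
  -- For a graph `y(x)` this is `x y' - y`, whose derivative reduces to `x` times that of the slope.
  -- It says that the tangent line meets the vertical axis at or below the contact.
  have hH : MonotoneOn (fun t => c.co (A + Real.pi / 2) t / c.co A t * c.chartSlope A t -
      c.f t / c.co A t) (Icc a d) :=
    monotoneOn_Icc_of_hasDerivAt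
      (fun t ht => ((c.hasDerivAt_chartAbscissa (hch t ht).1.ne').mul
        (c.hasDerivAt_chartSlope (A := A) (hch t ht).2.ne')).sub
        (c.hasDerivAt_chartHeight (hch t ht).1.ne')) fun t ht => by
      have ht' := Ioo_subset_Icc_self ht
      rw [hQ t ht', show ∀ u v w x y : ℝ, u / v * w + x * y - u * w / v = x * y by intros; ring]
      exact mul_nonneg (hY0 t ht') (div_nonneg (mul_nonneg (hch t ht').1.le (hK t ht)) (sq_nonneg _))
  refine ⟨fun s hs t ht hst => ?_, fun t ht => ⟨?_, ?_⟩⟩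
  · have h1 := hF hs ht hst
    simp only at h1
    rw [div_le_div_iff₀ (hch s hs).1 (hch t ht).1] at h1
    linarith
  · have := mul_nonneg (hch t ht).2.le (hG0 t ht)
    rw [← hQ t ht] at this
    linarith
  · have h1 := hH (left_mem_Icc.2 had) ht ht.1
    simp only [ha, (isAngle_facts ha hA).2, zero_div, zero_mul, sub_zero] at h1
    have hx := (hch t ht).1
    have hs := (hch t ht).2
    have h2 : c.f t * c.dco (A + Real.pi / 2) t - c.df t * c.co (A + Real.pi / 2) t =
        -(c.spin t * (c.co (A + Real.pi / 2) t / c.co A t * c.chartSlope A t -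
      c.f t / c.co A t)) := by
      rw [chartSlope]
      field_simp
      rw [c.spin_eq A]; ring_nf
    rw [h2]
    have := mul_nonneg hs.le h1
    linarith

/-- Just after a counterclockwise contact both curvature and height are positive. -/
theorem exists_right_pos {a e : ℝ} (hae : a < e) (ha : c.f a = 0) (hs : 0 < c.spin a)
    (hfin : {t ∈ Icc a e | c.curv t = 0}.Finite) :
    ∃ d ∈ Ioo a e, ∀ t ∈ Ioc a d, 0 < c.curv t ∧ 0 < c.f t := by
  obtain ⟨A, hA⟩ : ∃ A, IsAngle A (c.z a) :=
    ⟨Complex.arg (c.z a), (Complex.norm_mul_exp_arg_mul_I _).symm⟩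
  obtain ⟨d₁, hd₁, hch⟩ := exists_chart hae ha hA hs
  -- The contact itself may be an inflection; every other zero of the curvature is kept away from a
  -- short interval to its right.
  have hfin' : ({t ∈ Icc a e | c.curv t = 0} \ {a}).Finite := hfin.sdiff
  obtain ⟨d, hd, hne⟩ := exists_Icc_right hd₁.1 (nhdsWithin_le_nhds
    (hfin'.isClosed.isOpen_compl.mem_nhds (fun h => h.2 rfl : a ∈ _)))
  have hne0 : ∀ t ∈ Ioc a d, c.curv t ≠ 0 := fun t ht h0 =>
    hne t ⟨ht.1.le, ht.2⟩ ⟨⟨⟨ht.1.le, by linarith [ht.2, hd.2, hd₁.2]⟩, h0⟩, ht.1.ne'⟩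
  have hdm : d ∈ Ioc a d := ⟨hd.1, le_rfl⟩
  have hconst : ∀ σ : ℝ, 0 < σ * c.curv d → ∀ t ∈ Ioc a d, 0 < σ * c.curv t := by
    intro σ hσ t ht
    by_contra! hle
    have hiv := (isPreconnected_Ioc (a := a) (b := d)).intermediate_value (f := fun t => σ * c.curv t) ht hdm
      (continuous_const.mul c.continuous_curv).continuousOn
    obtain ⟨x, hx, hx0⟩ := hiv ⟨hle, hσ.le⟩
    rcases mul_eq_zero.1 hx0 with h | h
    · rw [h] at hσ; simp at hσ
    · exact hne0 x hx h
  have hch' : ∀ t ∈ Icc a d, 0 < c.co A t ∧ 0 < c.spin t :=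
    fun t ht => hch t ⟨ht.1, ht.2.trans hd.2.le⟩
  -- Negative curvature would bend the curve below its tangent at the contact, which is the equator.
  have hpos : 0 < c.curv d := by
    by_contra! hle
    have hlt := lt_of_le_of_ne hle (hne0 d hdm)
    have := height_pos_of_curv_pos (σ := -1) ha hch'
      (fun t ht => hconst (-1) (by linarith) t (Ioo_subset_Ioc_self ht)) hdm
    linarith [c.nonneg d]
  refine ⟨d, ⟨hd.1, hd.2.trans hd₁.2⟩, fun t ht => ⟨?_, ?_⟩⟩
  · simpa using hconst 1 (by simpa using hpos) t ht
  · simpa using height_pos_of_curv_pos (σ := 1) ha hch'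
      (fun t ht => hconst 1 (by linarith) t (Ioo_subset_Ioc_self ht)) ht

/-- Traversing the mirror image backwards preserves the signs of curvature and spin and exchanges
the two sides of a contact. -/
theorem exists_left_pos {b e : ℝ} (heb : e < b) (hb : c.f b = 0) (hs : 0 < c.spin b)
    (hfin : {t ∈ Icc e b | c.curv t = 0}.Finite) :
    ∃ d ∈ Ioo e b, ∀ t ∈ Ico d b, 0 < c.curv t ∧ 0 < c.f t := by
  obtain ⟨d, hd, h⟩ := exists_right_pos (c := c.reverse) (a := -b) (e := -e) (by linarith)
    (by simpa using hb) (by rw [reverse_spin, neg_neg]; exact hs) (by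
      refine (hfin.image Neg.neg).subset ?_
      rintro t ⟨⟨h1, h2⟩, h3⟩
      rw [reverse_curv] at h3
      exact ⟨-t, ⟨⟨by linarith, by linarith⟩, h3⟩, neg_neg t⟩)
  refine ⟨-d, ⟨by linarith [hd.2], by linarith [hd.1]⟩, fun t ht => ?_⟩
  have := h (-t) ⟨by linarith [ht.2], by linarith [ht.1]⟩
  rwa [reverse_curv, reverse_f, neg_neg] at this

end HemisphereCurve

/-! ### Hopf's argument on a triangle of times -/

/-- The triangle `a ≤ s ≤ t ≤ b` without its corners. -/
def cornerlessTriangle (a b : ℝ) : Set (ℝ × ℝ) :=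
  {q | a ≤ q.1 ∧ q.1 ≤ q.2 ∧ q.2 ≤ b ∧ 0 < (q.1 - a) + (q.2 - a) ∧
    0 < (b - q.1) + (b - q.2) ∧ 0 < (q.1 - a) + (b - q.2)}

theorem convex_cornerlessTriangle (a b : ℝ) : Convex ℝ (cornerlessTriangle a b) := by
  rintro p ⟨p1, p2, p3, p5, p6, p7⟩ q ⟨q1, q2, q3, q5, q6, q7⟩ u v hu hv huv
  have hv' : v = 1 - u := by linarith
  simp only [cornerlessTriangle, mem_ofPred_eq, Prod.fst_add, Prod.snd_add, Prod.smul_fst,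
    Prod.smul_snd, smul_eq_mul]
  have h1 := nonneg_of_convex_comb hu hv (sub_nonneg.2 p1) (sub_nonneg.2 q1)
  have h2 := nonneg_of_convex_comb hu hv (sub_nonneg.2 p2) (sub_nonneg.2 q2)
  have h3 := nonneg_of_convex_comb hu hv (sub_nonneg.2 p3) (sub_nonneg.2 q3)
  have h5 := pos_of_convex_comb hu hv huv p5 q5
  have h6 := pos_of_convex_comb hu hv huv p6 q6
  have h7 := pos_of_convex_comb hu hv huv p7 q7
  subst hv'
  refine ⟨?_, ?_, ?_, ?_, ?_, ?_⟩ <;> linarith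

/-- The mean of `g` over the interval from `s` to `t`. -/
def intervalMean {E : Type*} [NormedAddCommGroup E] [NormedSpace ℝ E] (g : ℝ → E) (q : ℝ × ℝ) : E :=
  ∫ τ in (0 : ℝ)..1, g (q.1 + (q.2 - q.1) * τ)

theorem continuous_intervalMean {E : Type*} [NormedAddCommGroup E] [NormedSpace ℝ E] {g : ℝ → E}
    (hg : Continuous g) : Continuous (intervalMean g) := by
  unfold intervalMean
  apply intervalIntegral.continuous_parametric_intervalIntegral_of_continuous'
  simp only [Function.uncurry_def]
  fun_prop

theorem smul_intervalMean {E : Type*} [NormedAddCommGroup E] [NormedSpace ℝ E] [CompleteSpace E]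
    {g g' : ℝ → E} (h : ∀ t, HasDerivAt g (g' t) t) (hg : Continuous g') (q : ℝ × ℝ) :
    (q.2 - q.1) • intervalMean g' q = g q.2 - g q.1 := by
  rw [intervalMean, intervalIntegral.smul_integral_comp_add_mul]
  simp only [mul_zero, mul_one, add_zero, add_sub_cancel]
  exact intervalIntegral.integral_eq_sub_of_hasDerivAt (fun x _ => h x) (hg.intervalIntegrable _ _)

theorem intervalMean_diag {E : Type*} [NormedAddCommGroup E] [NormedSpace ℝ E] [CompleteSpace E]
    (g : ℝ → E) (t : ℝ) : intervalMean g (t, t) = g t := by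
  simp [intervalMean]

/-- A continuous angle of a differentiable curve is differentiable. -/
theorem hasDerivAt_angle {E : ℝ → ℂ} {E' : ℂ} {ψ : ℝ → ℝ} {t₀ : ℝ} (hE : HasDerivAt E E' t₀)
    (h0 : E t₀ ≠ 0) (hψ : ContinuousAt ψ t₀) (hang : ∀ᶠ t in 𝓝 t₀, IsAngle (ψ t) (E t)) :
    HasDerivAt ψ (E' / E t₀).im t₀ := by
  have hpi := Real.pi_pos
  have h1 : HasDerivAt (fun t => E t / E t₀) (E' / E t₀) t₀ := hE.div_const _
  have h2 := h1.clog_real (by simp [h0])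
  have h3 : HasDerivAt (fun t => (Complex.log (E t / E t₀)).im) (E' / E t₀).im t₀ := by
    refine (Complex.imCLM.hasFDerivAt.comp_hasDerivAt t₀ h2).congr_deriv ?_
    simp [div_self h0]
  have h4 := h3.const_add (ψ t₀)
  refine h4.congr_of_eventuallyEq ?_
  have hnear : ∀ᶠ t in 𝓝 t₀, |ψ t - ψ t₀| < Real.pi := by
    have : ContinuousAt (fun t => |ψ t - ψ t₀|) t₀ := (hψ.sub continuousAt_const).abs
    exact this.eventually_lt_const (by simpa using hpi)
  filter_upwards [hang, hnear, hE.continuousAt.eventually_ne h0] with t ht hlt hne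
  have hq : E t / E t₀ ≠ 0 := div_ne_zero hne h0
  have hang0 := hang.self_of_nhds
  have ha : IsAngle (ψ t - ψ t₀) (E t / E t₀) := by
    refine isAngle_of_eq (r := ‖E t‖ / ‖E t₀‖) (by positivity) ?_
    have e1 : E t = _ := ht
    have e2 : E t₀ = _ := hang0
    have hn : (‖E t₀‖ : ℂ) ≠ 0 := by simpa using h0
    have := Complex.exp_ne_zero (ψ t₀ * Complex.I)
    conv_lhs => rw [e1, e2]
    rw [Complex.ofReal_sub, sub_mul, Complex.exp_sub]
    push_cast
    field_simp
  have hb : IsAngle (E t / E t₀).arg (E t / E t₀) := (Complex.norm_mul_exp_arg_mul_I _).symm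
  have hargle := Complex.abs_arg_le_pi (E t / E t₀)
  have := ha.eq_of_abs_lt hb hq (by
    have := abs_sub (ψ t - ψ t₀) (E t / E t₀).arg
    linarith)
  rw [Complex.log_im, ← this]; ring

namespace HemisphereCurve

variable {P : ℝ} (c : HemisphereCurve P)

/-- The velocity of the curve in the gnomonic projection, up to a positive factor. -/
def tangentVec (t : ℝ) : ℂ := c.f t * c.dz t - c.df t * c.z t

/-- The secant vector divided by the parameter difference, extended to the diagonal. -/
def secantQuot (q : ℝ × ℝ) : ℂ := c.f q.1 * intervalMean c.dz q - intervalMean c.df q * c.z q.1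

theorem continuous_secantQuot : Continuous c.secantQuot := by
  have := continuous_intervalMean c.continuous_dz
  have := continuous_intervalMean c.continuous_df
  have := c.continuous_f
  have := c.continuous_z
  unfold secantQuot; fun_prop

theorem secantQuot_diag (t : ℝ) : c.secantQuot (t, t) = c.tangentVec t := by
  simp [secantQuot, tangentVec, intervalMean_diag]

theorem mul_secantQuot (q : ℝ × ℝ) : ((q.2 - q.1 : ℝ) : ℂ) * c.secantQuot q = secant c.z c.f q := by
  have h1 := smul_intervalMean c.hz c.continuous_dz q
  have h2 := smul_intervalMean c.hf c.continuous_df q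
  rw [Complex.real_smul] at h1
  rw [smul_eq_mul] at h2
  have h2 : ((q.2 - q.1 : ℝ) : ℂ) * ((intervalMean c.df q : ℝ) : ℂ) = c.f q.2 - c.f q.1 := by
    rw [← Complex.ofReal_mul, h2]; push_cast; rfl
  rw [secantQuot, secant]
  linear_combination (c.f q.1 : ℂ) * h1 - c.z q.1 * h2

theorem secantQuot_eq {q : ℝ × ℝ} (h : q.1 < q.2) :
    c.secantQuot q = ((1 / (q.2 - q.1) : ℝ) : ℂ) * secant c.z c.f q := by
  have h1 : ((q.2 - q.1 : ℝ) : ℂ) ≠ 0 := by exact_mod_cast (sub_pos.2 h).ne'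
  rw [← c.mul_secantQuot, ← mul_assoc, ← Complex.ofReal_mul,
    one_div_mul_cancel (sub_pos.2 h).ne']
  simp

theorem hasDerivAt_tangentVec (t : ℝ) :
    HasDerivAt c.tangentVec (c.f t * c.ddz t - c.ddf t * c.z t) t := by
  have h := (((c.hf t).ofReal_comp).mul (c.hdz t)).sub (((c.hdf t).ofReal_comp).mul (c.hz t))
  refine h.congr_deriv ?_
  ring

theorem tangentVec_ne_zero {t : ℝ} (h : 0 < c.f t) : c.tangentVec t ≠ 0 := by
  intro h0
  rw [tangentVec, sub_eq_zero] at h0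
  have hre := congrArg Complex.re h0
  have him := congrArg Complex.im h0
  rw [Complex.re_ofReal_mul, Complex.re_ofReal_mul] at hre
  rw [Complex.im_ofReal_mul, Complex.im_ofReal_mul] at him
  have h1 := c.tangency t
  have h2 := c.norm_eq t
  have h3 : c.df t = 0 := by
    linear_combination c.f t * h1 - (c.z t).re * hre - (c.z t).im * him - c.df t * h2
  rw [h3, zero_mul] at hre him
  refine c.reg t (Complex.ext ?_ ?_) h3
  · simpa using (mul_eq_zero.1 hre).resolve_left h.ne'
  · simpa using (mul_eq_zero.1 him).resolve_left h.ne'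

theorem secant_ne_zero {s t : ℝ} (hst : s < t) (ht : t < s + P) (hs0 : 0 < c.f s) (ht0 : 0 < c.f t) :
    secant c.z c.f (s, t) ≠ 0 := by
  intro h0
  obtain ⟨r, hr⟩ : ∃ r, r = c.f t / c.f s := ⟨_, rfl⟩
  have hr0 : 0 < r := by rw [hr]; positivity
  have hrf : c.f t = r * c.f s := by rw [hr]; field_simp
  have hzr : c.z t = r * c.z s := by
    have h1 : (c.f s : ℂ) ≠ 0 := by exact_mod_cast hs0.ne'
    apply mul_left_cancel₀ h1
    rw [secant, sub_eq_zero] at h0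
    rw [h0, hrf]; push_cast; ring
  have hr1 : r = 1 := by
    have h1 := c.norm_eq t
    have h2 := c.norm_eq s
    rw [hzr, hrf, Complex.re_ofReal_mul, Complex.im_ofReal_mul] at h1
    have h3 : r ^ 2 = 1 := by linear_combination h1 - r ^ 2 * h2
    nlinarith
  rw [hr1] at hzr hrf
  exact c.inj s t hst ht (by simpa using hzr.symm) (by simpa using hrf.symm)

/-- This is the turning rate of the projected tangent. Above the equator it has the sign of the
curvature. -/
theorem im_tangentVec_div (t : ℝ) :
    ((c.f t * c.ddz t - c.ddf t * c.z t) / c.tangentVec t).im =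
      c.f t * c.curv t / Complex.normSq (c.tangentVec t) := by
  rw [Complex.div_im, div_sub_div_same]
  congr 1
  simp [tangentVec, curv]
  ring

theorem dirComp_tangentVec (A t : ℝ) :
    dirComp A (c.tangentVec t) = c.f t * c.dco A t - c.df t * c.co A t := by
  rw [tangentVec, dirComp_sub, dirComp_smul, dirComp_smul, dco, co]

variable {c}

/-- After the contact the projected curve comes in from infinity in direction `A`. Its secants point
into the half-plane opposite to `A`, and its tangent has turned from `A + π` to the counterclockwise
side. -/
theorem exists_right_inequalities {a e A : ℝ} (hae : a < e) (ha : c.f a = 0)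
    (hA : IsAngle A (c.z a)) (hs : 0 < c.spin a) (hK : ∀ t ∈ Ioo a e, 0 ≤ c.curv t) :
    ∃ d ∈ Ioo a e,
      (∀ s ∈ Icc a d, ∀ t ∈ Icc a d, s ≤ t → dirComp A (secant c.z c.f (s, t)) ≤ 0) ∧
      ∀ t ∈ Icc a d, dirComp A (c.tangentVec t) ≤ 0 ∧
        dirComp (A + Real.pi / 2) (c.tangentVec t) ≤ 0 := by
  obtain ⟨d, hd, hch⟩ := exists_chart hae ha hA hs
  obtain ⟨h1, h2⟩ := chart_inequalities ha hA hch (fun t ht => hK t ⟨ht.1, ht.2.trans hd.2⟩)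
  refine ⟨d, hd, fun s hs t ht hst => ?_, fun t ht => ?_⟩
  · rw [dirComp_secant]; exact h1 s hs t ht hst
  · rw [dirComp_tangentVec, dirComp_tangentVec]; exact h2 t ht

theorem dirComp_neg_neg_conj (B : ℝ) (w : ℂ) : dirComp (-B) (-(starRingEnd ℂ) w) = -dirComp B w := by
  simp [dirComp]; ring

theorem dirComp_neg_add_neg_conj (B : ℝ) (w : ℂ) :
    dirComp (-B + Real.pi / 2) (-(starRingEnd ℂ) w) = dirComp (B + Real.pi / 2) w := by
  simp [dirComp_add_pi_div_two]

theorem isAngle_conj {B : ℝ} {w : ℂ} (h : IsAngle B w) : IsAngle (-B) ((starRingEnd ℂ) w) := by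
  refine isAngle_of_eq (r := ‖w‖) (norm_nonneg _) ?_
  conv_lhs => rw [show w = _ from h]
  rw [map_mul, Complex.conj_ofReal, ← Complex.exp_conj]
  simp

theorem exists_left_inequalities {b e B : ℝ} (heb : e < b) (hb : c.f b = 0)
    (hB : IsAngle B (c.z b)) (hs : 0 < c.spin b) (hK : ∀ t ∈ Ioo e b, 0 ≤ c.curv t) :
    ∃ d ∈ Ioo e b,
      (∀ s ∈ Icc d b, ∀ t ∈ Icc d b, s ≤ t → 0 ≤ dirComp B (secant c.z c.f (s, t))) ∧
      ∀ t ∈ Icc d b, 0 ≤ dirComp B (c.tangentVec t) ∧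
        dirComp (B + Real.pi / 2) (c.tangentVec t) ≤ 0 := by
  obtain ⟨d, hd, h1, h2⟩ := exists_right_inequalities (c := c.reverse) (a := -b) (e := -e) (A := -B)
    (by linarith) (by simpa using hb) (by simpa using isAngle_conj hB)
    (by rw [reverse_spin, neg_neg]; exact hs)
    (fun t ht => by rw [reverse_curv]; exact hK _ ⟨by linarith [ht.2], by linarith [ht.1]⟩)
  refine ⟨-d, ⟨by linarith [hd.2], by linarith [hd.1]⟩, fun s hs t ht hst => ?_, fun t ht => ?_⟩
  · have := h1 (-t) ⟨by linarith [ht.2], by linarith [ht.1]⟩ (-s)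
      ⟨by linarith [hs.2], by linarith [hs.1]⟩ (by linarith)
    have e : secant c.reverse.z c.reverse.f (-t, -s) = -(starRingEnd ℂ) (secant c.z c.f (s, t)) := by
      simp [secant]
    rw [e, dirComp_neg_neg_conj] at this
    linarith
  · have := h2 (-t) ⟨by linarith [ht.2], by linarith [ht.1]⟩
    have e : c.reverse.tangentVec (-t) = -(starRingEnd ℂ) (c.tangentVec t) := by
      simp [tangentVec, reverse]; ring
    rw [e, dirComp_neg_neg_conj, dirComp_neg_add_neg_conj] at this
    exact ⟨by linarith [this.1], this.2⟩

/-- An arc between successive counterclockwise contacts at angular distance at most `π` must have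
negative curvature somewhere. -/
theorem exists_curv_neg_of_adjacent {a b : ℝ} (hab : a < b) (hbP : b ≤ a + P)
    (ha : c.f a = 0) (hb : c.f b = 0) (hsa : 0 < c.spin a) (hsb : 0 < c.spin b)
    (hpos : ∀ t ∈ Ioo a b, 0 < c.f t) {A B : ℝ} (hA : IsAngle A (c.z a)) (hB : IsAngle B (c.z b))
    (hAB : A < B) (hBA : B ≤ A + Real.pi) (hfin : {t ∈ Icc a b | c.curv t = 0}.Finite) :
    ∃ t ∈ Ioo a b, c.curv t < 0 := by
  by_contra! hK
  have hpi := Real.pi_pos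
  have hmid : a < (a + b) / 2 ∧ (a + b) / 2 < b := ⟨by linarith, by linarith⟩
  obtain ⟨a₀, ha₀, Hsa, Hta⟩ := exists_right_inequalities hmid.1 ha hA hsa
    (fun t ht => hK t ⟨ht.1, ht.2.trans hmid.2⟩)
  obtain ⟨b₀, hb₀, Hsb, Htb⟩ := exists_left_inequalities hmid.2 hb hB hsb
    (fun t ht => hK t ⟨hmid.1.trans ht.1, ht.2⟩)
  obtain ⟨a₁, ha₁, Ha⟩ := exists_Icc_right ha₀.1 (nhdsWithin_le_nhds
    (eventually_dirComp_nonpos c.continuous_z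
      (hA.dirComp_neg_of_corner (z_ne_zero ha) hAB (by linarith))))
  obtain ⟨b₁, hb₁, Hb⟩ := exists_Icc_left hb₀.2 (nhdsWithin_le_nhds
    (eventually_dirComp_nonneg c.continuous_z
      (hB.dirComp_pos_of_corner (z_ne_zero hb) hAB (by linarith))))
  have ha₁' := ha₁.2.trans ha₀.2
  have hb₁' := hb₀.1.trans hb₁.1
  have hab₁ := ha₁'.trans hb₁'
  set T := cornerlessTriangle a b
  have hconv := convex_cornerlessTriangle a b
  -- Secants from the first contact have direction `A + π`, and secants to the second have direction
  -- `B`.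
  have ea : ∀ {t}, a < t → c.secantQuot (a, t) = ((1 / (t - a) * c.f t : ℝ) : ℂ) * -c.z a := by
    intro t ht
    rw [c.secantQuot_eq ht]; simp [secant, ha]; ring
  have eb : ∀ {s}, s < b → c.secantQuot (s, b) = ((1 / (b - s) * c.f s : ℝ) : ℂ) * c.z b := by
    intro s hs
    rw [c.secantQuot_eq hs]; simp [secant, hb]; ring
  have nna : ∀ {t}, a < t → 0 ≤ 1 / (t - a) * c.f t := fun h =>
    mul_nonneg (one_div_nonneg.2 (sub_pos.2 h).le) (c.nonneg _)
  have nnb : ∀ {s}, s < b → 0 ≤ 1 / (b - s) * c.f s := fun h =>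
    mul_nonneg (one_div_nonneg.2 (sub_pos.2 h).le) (c.nonneg _)
  have hD0 : ∀ q ∈ T, c.secantQuot q ≠ 0 := by
    rintro ⟨s, t⟩ ⟨p1, p2, p3, p5, p6, p7⟩
    dsimp only at *
    rcases p2.eq_or_lt with rfl | p2
    · rw [secantQuot_diag]
      exact c.tangentVec_ne_zero (hpos s ⟨by linarith, by linarith⟩)
    rw [c.secantQuot_eq p2]
    refine mul_ne_zero (by exact_mod_cast (one_div_pos.2 (sub_pos.2 p2)).ne') ?_
    rcases p1.eq_or_lt with rfl | p1
    · have := hpos t ⟨p2, by linarith⟩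
      simp only [secant, ha, Complex.ofReal_zero, zero_mul, zero_sub, neg_ne_zero]
      exact mul_ne_zero (by exact_mod_cast this.ne') (z_ne_zero ha)
    rcases p3.eq_or_lt with rfl | p3
    · have := hpos s ⟨p1, p2⟩
      simp only [secant, hb, Complex.ofReal_zero, zero_mul, sub_zero]
      exact mul_ne_zero (by exact_mod_cast this.ne') (z_ne_zero hb)
    exact c.secant_ne_zero p2 (by linarith) (hpos s ⟨p1, p2.trans p3⟩) (hpos t ⟨p1.trans p2, p3⟩)
  have mem_a : ∀ {t}, t ∈ Ioo a b → (a, t) ∈ T := fun {t} h => by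
    refine ⟨?_, ?_, ?_, ?_, ?_, ?_⟩ <;> dsimp only <;> linarith [h.1, h.2]
  have mem_b : ∀ {s}, s ∈ Ioo a b → (s, b) ∈ T := fun {t} h => by
    refine ⟨?_, ?_, ?_, ?_, ?_, ?_⟩ <;> dsimp only <;> linarith [h.1, h.2]
  have mem_d : ∀ {s}, s ∈ Ioo a b → (s, s) ∈ T := fun {t} h => by
    refine ⟨?_, ?_, ?_, ?_, ?_, ?_⟩ <;> dsimp only <;> linarith [h.1, h.2]
  have ma : a₁ ∈ Ioo a b := ⟨ha₁.1, by linarith⟩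
  have mb : b₁ ∈ Ioo a b := ⟨by linarith, hb₁.2⟩
  obtain ⟨θ, hθ, hang, hθa⟩ := exists_continuousOn_angle hconv
    c.continuous_secantQuot.continuousOn hD0 (mem_a mb) (θ₀ := A + Real.pi) (by
      rw [ea mb.1]; exact hA.add_pi.real_mul (nna mb.1))
  have corner : ∀ {p q : ℝ × ℝ} (α : ℝ), p ∈ T → q ∈ T →
      (∀ x ∈ segment ℝ p q, x ∈ T → 0 ≤ dirComp α (c.secantQuot x)) →
      |θ p - α| ≤ Real.pi / 2 → |θ q - α| ≤ Real.pi / 2 := by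
    intro p q α hp hq h1 h
    exact abs_angle_sub_le hθ hang hD0 (hconv.segment_subset hp hq)
      (convex_segment p q).isPreconnected
      (fun x hx => h1 x hx (hconv.segment_subset hp hq hx))
      (left_mem_segment ℝ p q) (right_mem_segment ℝ p q) h
  have edge : ∀ {p q : ℝ × ℝ} {α : ℝ}, p ∈ T → q ∈ T →
      (∀ x ∈ segment ℝ p q, IsAngle α (c.secantQuot x)) → θ p = α → θ q = α := by
    intro p q α hp hq h h'
    exact angle_eq_of_isAngle hθ hang hD0 (hconv.segment_subset hp hq)
      (convex_segment p q).isPreconnected h (left_mem_segment ℝ p q) (right_mem_segment ℝ p q) h'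
  have hseg : ∀ {p q x : ℝ × ℝ}, x ∈ segment ℝ p q → x.1 ∈ uIcc p.1 q.1 ∧ x.2 ∈ uIcc p.2 q.2 := by
    intro p q x hx
    rw [← segment_eq_uIcc, ← segment_eq_uIcc]
    exact Prod.segment_subset (𝕜 := ℝ) p q hx
  -- Cutting off the corner `(a, b)` selects the branch `B`, rather than `B` plus a multiple of 2π.
  have h1 : θ (a₁, b) = B := by
    have := corner ((A + B) / 2 + Real.pi / 2) (mem_a mb) (mem_b ma) (fun x hx hxT => by
        have hx' := hseg hx
        rw [uIcc_of_le ma.1.le, uIcc_of_le mb.2.le] at hx'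
        rw [c.secantQuot_eq (by linarith [hx'.1.2, hx'.2.1]), dirComp_smul]
        refine mul_nonneg (one_div_nonneg.2 (by linarith [hx'.1.2, hx'.2.1])) ?_
        rw [dirComp_secant]
        have := mul_nonneg (c.nonneg x.1) (Hb _ hx'.2)
        have := mul_nonneg (c.nonneg x.2) (neg_nonneg.2 (Ha _ hx'.1))
        linarith)
      (by rw [hθa, abs_le]; constructor <;> linarith)
    refine (hang _ (mem_b ma)).eq_of_abs_lt (η := B) ?_ (hD0 _ (mem_b ma)) ?_
    · rw [eb ma.2]; exact hB.real_mul (nnb ma.2)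
    · rw [abs_le] at this; rw [abs_lt]; constructor <;> linarith
  have h2 : θ (b₁, b) = B := by
    refine edge (mem_b ma) (mem_b mb) (fun x hx => ?_) h1
    have hx' := hseg hx
    rw [uIcc_of_le hab₁.le, uIcc_self] at hx'
    rw [show x = (x.1, b) from Prod.ext rfl hx'.2, eb (by linarith [hx'.1.2, mb.2])]
    exact hB.real_mul (nnb (by linarith [hx'.1.2, mb.2]))
  have h3 : θ (a, a₁) = A + Real.pi := by
    refine edge (mem_a mb) (mem_a ma) (fun x hx => ?_) hθa
    have hx' := hseg hx
    rw [uIcc_of_ge hab₁.le, uIcc_self] at hx'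
    rw [show x = (a, x.2) from Prod.ext hx'.1 rfl, ea (by linarith [hx'.2.1, ma.1])]
    exact hA.add_pi.real_mul (nna (by linarith [hx'.2.1, ma.1]))
  -- The secants keep the angle within π/2 of `A + π`. Within this range the sign of the transverse
  -- component of the tangent puts it at or above `A + π`.
  have h4 : A + Real.pi ≤ θ (a₁, a₁) := by
    have := corner (A + Real.pi) (mem_a ma) (mem_d ma) (fun x hx hxT => by
        have hx' := hseg hx
        rw [uIcc_of_le ma.1.le, uIcc_self] at hx'
        have hx2 : x.2 = a₁ := hx'.2
        rw [dirComp_add_pi]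
        rcases hxT.2.1.eq_or_lt with h | h
        · rw [show x = (a₁, a₁) from Prod.ext (h.trans hx2) hx2, secantQuot_diag]
          linarith [(Hta a₁ ⟨ma.1.le, ha₁.2.le⟩).1]
        · rw [c.secantQuot_eq h, dirComp_smul]
          have h5 := Hsa x.1 ⟨hx'.1.1, hx'.1.2.trans ha₁.2.le⟩ x.2
            ⟨by rw [hx2]; exact ma.1.le, by rw [hx2]; exact ha₁.2.le⟩ h.le
          have := mul_nonneg (one_div_nonneg.2 (sub_pos.2 h).le) (neg_nonneg.2 h5)
          linarith)
      (by rw [h3]; simp; positivity)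
    have h5 := (Hta a₁ ⟨ma.1.le, ha₁.2.le⟩).2
    rw [← secantQuot_diag, (hang _ (mem_d ma)).dirComp,
      show θ (a₁, a₁) - (A + Real.pi / 2) = θ (a₁, a₁) - (A + Real.pi) + Real.pi / 2 by ring,
      Real.cos_add_pi_div_two] at h5
    have h6 := norm_pos_iff.2 (hD0 _ (mem_d ma))
    by_contra! hlt
    rw [abs_le] at this
    have := Real.sin_neg_of_neg_of_neg_pi_lt (sub_neg.2 hlt) (by linarith)
    have := mul_pos h6 (neg_pos.2 this)
    linarith
  have h5 : θ (b₁, b₁) ≤ B := by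
    have := corner B (mem_b mb) (mem_d mb) (fun x hx hxT => by
        have hx' := hseg hx
        rw [uIcc_self, uIcc_of_ge mb.2.le] at hx'
        have hx1 : x.1 = b₁ := hx'.1
        rcases hxT.2.1.eq_or_lt with h | h
        · rw [show x = (b₁, b₁) from Prod.ext hx1 (h.symm.trans hx1), secantQuot_diag]
          exact (Htb b₁ ⟨hb₁.1.le, mb.2.le⟩).1
        · rw [c.secantQuot_eq h, dirComp_smul]
          have h5 := Hsb x.1 ⟨by rw [hx1]; exact hb₁.1.le, by rw [hx1]; exact mb.2.le⟩ x.2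
            ⟨hb₁.1.le.trans hx'.2.1, hx'.2.2⟩ h.le
          exact mul_nonneg (one_div_nonneg.2 (sub_pos.2 h).le) h5)
      (by rw [h2]; simp; positivity)
    have h5 := (Htb b₁ ⟨hb₁.1.le, mb.2.le⟩).2
    rw [← secantQuot_diag, (hang _ (mem_d mb)).dirComp,
      show θ (b₁, b₁) - (B + Real.pi / 2) = θ (b₁, b₁) - B - Real.pi / 2 by ring,
      Real.cos_sub_pi_div_two] at h5
    have h6 := norm_pos_iff.2 (hD0 _ (mem_d mb))
    by_contra! hlt
    rw [abs_le] at this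
    have := Real.sin_pos_of_pos_of_lt_pi (sub_pos.2 hlt) (by linarith)
    have := mul_pos h6 this
    linarith
  let ψ : ℝ → ℝ := fun t => θ (t, t)
  have hψd : ∀ t ∈ Ioo a b,
      HasDerivAt ψ (c.f t * c.curv t / Complex.normSq (c.tangentVec t)) t := by
    intro t ht
    rw [← c.im_tangentVec_div]
    have hdiag : ContinuousOn ψ (Ioo a b) :=
      hθ.comp (by fun_prop : ContinuousOn (fun t : ℝ => (t, t)) (Ioo a b)) fun s hs => mem_d hs
    refine hasDerivAt_angle (c.hasDerivAt_tangentVec t) (c.tangentVec_ne_zero (hpos t ht))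
      (hdiag.continuousAt (Ioo_mem_nhds ht.1 ht.2)) ?_
    filter_upwards [Ioo_mem_nhds ht.1 ht.2] with s hs
    rw [← secantQuot_diag]
    exact hang _ (mem_d hs)
  have hsub : Icc a₁ b₁ ⊆ Ioo a b := fun t ht => ⟨ma.1.trans_le ht.1, ht.2.trans_lt mb.2⟩
  -- The tangent angle increases from at least `A + π` to at most `B ≤ A + π`, so it is constant.
  have hmono : MonotoneOn ψ (Icc a₁ b₁) :=
    monotoneOn_Icc_of_hasDerivAt (fun t ht => hψd t (hsub ht)) fun t ht => by
      have ht' := hsub (Ioo_subset_Icc_self ht)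
      exact div_nonneg (mul_nonneg (c.nonneg t) (hK t ht')) (Complex.normSq_nonneg _)
  have hconst : ∀ t ∈ Icc a₁ b₁, ψ t = B := by
    intro t ht
    have e1 := hmono (left_mem_Icc.2 hab₁.le) ht ht.1
    have e2 := hmono ht (right_mem_Icc.2 hab₁.le) ht.2
    simp only [ψ] at *
    linarith
  -- A constant tangent angle makes every time of the interval a zero of the curvature, and there
  -- are only finitely many.
  refine (Ioo_infinite hab₁) (hfin.subset fun t ht => ?_)
  have ht' := hsub (Ioo_subset_Icc_self ht)
  refine ⟨Ioo_subset_Icc_self ht', ?_⟩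
  have e1 : HasDerivAt ψ 0 t := (hasDerivAt_const t B).congr_of_eventuallyEq (by
    filter_upwards [Ioo_mem_nhds ht.1 ht.2] with s hs
    exact hconst s (Ioo_subset_Icc_self hs))
  have e2 := (hψd t ht').unique e1
  have e3 := Complex.normSq_pos.2 (c.tangentVec_ne_zero (hpos t ht'))
  rcases div_eq_zero_iff.1 e2 with h | h
  · exact (mul_eq_zero.1 h).resolve_left (hpos t ht').ne'
  · exact absurd h e3.ne'

end HemisphereCurve

/-! ### Sign changes of the curvature between contacts -/

theorem exists_angle_Ioc (w : ℂ) (A : ℝ) : ∃ B ∈ Ioc A (A + 2 * Real.pi), IsAngle B w := by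
  have h2 : (0 : ℝ) < 2 * Real.pi := by positivity
  refine ⟨toIocMod h2 A w.arg, toIocMod_mem_Ioc h2 A w.arg, ?_⟩
  rw [toIocMod, zsmul_eq_mul]
  refine isAngle_of_eq (r := ‖w‖) (norm_nonneg _) ?_
  conv_lhs => rw [← Complex.norm_mul_exp_arg_mul_I w]
  congr 1
  rw [Complex.exp_eq_exp_iff_exists_int]
  refine ⟨toIocDiv h2 A w.arg, ?_⟩
  push_cast; ring

theorem IsAngle.add_two_pi {θ : ℝ} {w : ℂ} (h : IsAngle θ w) : IsAngle (θ + 2 * Real.pi) w := by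
  have := h.add_pi.add_pi
  rw [neg_neg] at this
  convert this using 1; ring

/-- `k` has an isolated zero at `t`, around which it takes both signs. -/
def IsSignChange (k : ℝ → ℝ) (t : ℝ) : Prop :=
  k t = 0 ∧ ∃ ε > 0, (∀ s ∈ Ioo (t - ε) (t + ε), k s = 0 → s = t) ∧
    ∃ x ∈ Ioo (t - ε) (t + ε), ∃ y ∈ Ioo (t - ε) (t + ε), k x < 0 ∧ 0 < k y

theorem IsSignChange.of_neg {k : ℝ → ℝ} {t : ℝ} (h : IsSignChange (fun t => -k t) t) :
    IsSignChange k t := by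
  obtain ⟨h0, ε, hε, h1, x, hx, y, hy, h2, h3⟩ := h
  exact ⟨neg_eq_zero.1 h0, ε, hε, fun s hs h => h1 s hs (neg_eq_zero.2 h), y, hy, x, hx,
    by linarith, by linarith⟩

theorem exists_signChange_of_pos_of_neg {k : ℝ → ℝ} (hk : Continuous k) {a b : ℝ} (hab : a < b)
    (hfin : {t ∈ Icc a b | k t = 0}.Finite) (ha : 0 < k a) (hb : k b < 0) :
    ∃ t ∈ Ioo a b, IsSignChange k t := by
  -- The sign change is at the infimum of the negative times: `k` is nonnegative before it and takes
  -- negative values arbitrarily close after it. Finiteness of the zeros makes it isolated.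
  set N := {τ ∈ Icc a b | k τ < 0} with hN
  have hbN : b ∈ N := ⟨right_mem_Icc.2 hab.le, hb⟩
  have hbdd : BddBelow N := ⟨a, fun τ h => h.1.1⟩
  obtain ⟨t, ht⟩ : ∃ t, t = sInf N := ⟨_, rfl⟩
  have hat : a ≤ t := ht ▸ le_csInf ⟨b, hbN⟩ fun τ h => h.1.1
  have htb : t ≤ b := ht ▸ csInf_le hbdd hbN
  have hleft : ∀ τ ∈ Ico a t, 0 ≤ k τ := by
    intro τ hτ
    by_contra! hlt
    have : t ≤ τ := ht ▸ csInf_le hbdd ⟨⟨hτ.1, hτ.2.le.trans htb⟩, hlt⟩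
    exact absurd hτ.2 (not_lt.2 this)
  have hright : ∀ ε > 0, ∃ x ∈ N, x < t + ε := fun ε hε =>
    exists_lt_of_csInf_lt ⟨b, hbN⟩ (by rw [← ht]; linarith)
  have hle : k t ≤ 0 := by
    by_contra! hlt
    obtain ⟨ε, hε, h⟩ := Metric.eventually_nhds_iff.1 (hk.continuousAt.eventually_const_lt hlt)
    obtain ⟨x, hx, hxt⟩ := hright ε hε
    have htx : t ≤ x := ht ▸ csInf_le hbdd hx
    have := h (show dist x t < ε by rw [Real.dist_eq, abs_lt]; constructor <;> linarith)
    exact absurd hx.2 (not_lt.2 this.le)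
  have hat' : a < t := lt_of_le_of_ne hat fun h => by rw [← h] at hle; linarith
  have h0 : k t = 0 := by
    refine le_antisymm hle ?_
    by_contra! hlt
    obtain ⟨d, hd, h⟩ := exists_Icc_left hat' (nhdsWithin_le_nhds
      (hk.continuousAt.eventually_lt_const hlt))
    have := h d ⟨le_rfl, hd.2.le⟩
    linarith [hleft d ⟨hd.1.le, hd.2⟩]
  have htb' : t < b := lt_of_le_of_ne htb fun h => by rw [h] at h0; linarith
  have hfin' : ({τ ∈ Icc a b | k τ = 0} \ {t}).Finite := hfin.sdiff
  have hev : ∀ᶠ s in 𝓝 t, s ∈ Ioo a b ∧ s ∉ ({τ ∈ Icc a b | k τ = 0} \ {t}) :=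
    Filter.Eventually.and (Ioo_mem_nhds hat' htb')
      (hfin'.isClosed.isOpen_compl.mem_nhds (fun h => h.2 rfl : t ∈ _))
  obtain ⟨ε, hε, h⟩ := Metric.eventually_nhds_iff.1 hev
  have h' : ∀ s ∈ Ioo (t - ε) (t + ε), s ∈ Ioo a b ∧ (k s = 0 → s = t) := by
    intro s hs
    have := h (show dist s t < ε by rw [Real.dist_eq, abs_lt]; constructor <;> linarith [hs.1, hs.2])
    refine ⟨this.1, fun hs0 => ?_⟩
    by_contra hne
    exact this.2 ⟨⟨Ioo_subset_Icc_self this.1, hs0⟩, hne⟩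
  refine ⟨t, ⟨hat', htb'⟩, h0, ε, hε, fun s hs => (h' s hs).2, ?_⟩
  obtain ⟨x, hx, hxt⟩ := hright ε hε
  have htx : t ≤ x := ht ▸ csInf_le hbdd hx
  have hy : t - ε / 2 ∈ Ioo (t - ε) (t + ε) := ⟨by linarith, by linarith⟩
  have hy' := h' _ hy
  refine ⟨x, ⟨by linarith, hxt⟩, t - ε / 2, hy, hx.2, ?_⟩
  refine lt_of_le_of_ne (hleft _ ⟨hy'.1.1.le, by linarith⟩) fun h1 => ?_
  have := hy'.2 h1.symm
  linarith

theorem exists_signChange_of_neg_of_pos {k : ℝ → ℝ} (hk : Continuous k) {a b : ℝ} (hab : a < b)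
    (hfin : {t ∈ Icc a b | k t = 0}.Finite) (ha : k a < 0) (hb : 0 < k b) :
    ∃ t ∈ Ioo a b, IsSignChange k t := by
  obtain ⟨t, ht, h⟩ := exists_signChange_of_pos_of_neg (k := fun t => -k t) hk.neg hab
    (by simpa using hfin) (by linarith) (by linarith)
  exact ⟨t, ht, h.of_neg⟩

namespace HemisphereCurve

variable {P : ℝ} {c : HemisphereCurve P}

/-- An arc between counterclockwise contacts at angular distance at most `π` must have
negative curvature somewhere. -/
theorem exists_curv_neg {a b : ℝ} (hab : a < b) (hbP : b < a + P)
    (ha : c.f a = 0) (hb : c.f b = 0) (hsa : 0 < c.spin a)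
    {A B : ℝ} (hA : IsAngle A (c.z a)) (hB : IsAngle B (c.z b))
    (hAB : A < B) (hBA : B ≤ A + Real.pi) (hfin : {t ∈ Icc a b | c.curv t = 0}.Finite) :
    ∃ t ∈ Ioo a b, c.curv t < 0 := by
  have hpi := Real.pi_pos
  obtain ⟨d, hd, hpos⟩ := exists_right_pos hab ha hsa hfin
  -- Hopf's argument needs adjacent contacts, so take the first contact `b'` after `a`.
  have hcomp : IsCompact (Icc d b ∩ c.f ⁻¹' {0}) :=
    isCompact_Icc.inter_right (isClosed_singleton.preimage c.continuous_f)
  obtain ⟨b', ⟨⟨hb'1, hb'2⟩, hb'0⟩, hleast⟩ :=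
    hcomp.exists_isLeast ⟨b, ⟨hd.2.le, le_rfl⟩, hb⟩
  have hb'0 : c.f b' = 0 := hb'0
  have hab' : a < b' := hd.1.trans_le hb'1
  have hpos' : ∀ t ∈ Ioo a b', 0 < c.f t := by
    intro t ht
    rcases le_or_gt t d with h | h
    · exact (hpos t ⟨ht.1, h⟩).2
    · refine lt_of_le_of_ne (c.nonneg t) fun h0 => ?_
      exact absurd (hleast ⟨⟨h.le, ht.2.le.trans hb'2⟩, h0.symm⟩) (not_le.2 ht.2)
  obtain ⟨B', hB'm, hB'⟩ := exists_angle_Ioc (c.z b') A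
  have hB'lt : B' < A + 2 * Real.pi := lt_of_le_of_ne hB'm.2 fun h => by
    rw [h] at hB'
    exact c.inj a b' hab' (by linarith) (isAngle_unique ha hb'0 hA.add_two_pi hB')
      (ha.trans hb'0.symm)
  have hsb' := spin_pos_of_spin_pos hab' (by linarith) ha hb'0 hA hB' hB'm.1 hB'lt hsa
  have hle : B' ≤ B := by
    rcases hb'2.eq_or_lt with rfl | hb'b
    · refine (hB'.eq_of_abs_lt hB (z_ne_zero hb) ?_).le
      rw [abs_lt]; constructor <;> linarith [hB'm.1]
    by_contra! hlt
    -- If `b'` were positioned beyond `b`, the mirror image would meet `a`, `b'`, `b` in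
    -- counterclockwise order, so the curve itself would move clockwise at `b'`.
    have := spin_pos_of_ordered (c := c.conj) hab' hb'b hbP.le ha hb'0 hb (isAngle_conj hA)
      (isAngle_conj hB').add_two_pi (isAngle_conj hB).add_two_pi (by linarith) (by linarith)
      (by linarith)
    rw [conj_spin] at this
    linarith
  obtain ⟨t, ht, h⟩ := exists_curv_neg_of_adjacent hab' (by linarith) ha hb'0 hsa hsb' hpos' hA hB'
    hB'm.1 (by linarith) (hfin.subset fun t ht => ⟨⟨ht.1.1, ht.1.2.trans hb'2⟩, ht.2⟩)
  exact ⟨t, ⟨ht.1, ht.2.trans_le hb'2⟩, h⟩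

/-- The curvature is positive next to both contacts and negative somewhere between them. -/
theorem exists_two_signChanges {a b : ℝ} (hab : a < b) (hbP : b < a + P)
    (ha : c.f a = 0) (hb : c.f b = 0) (hsa : 0 < c.spin a)
    {A B : ℝ} (hA : IsAngle A (c.z a)) (hB : IsAngle B (c.z b))
    (hAB : A < B) (hBA : B ≤ A + Real.pi) (hfin : ∀ u v, {t ∈ Icc u v | c.curv t = 0}.Finite) :
    ∃ t₁ t₂, a < t₁ ∧ t₁ < t₂ ∧ t₂ < b ∧ IsSignChange c.curv t₁ ∧ IsSignChange c.curv t₂ := by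
  have hpi := Real.pi_pos
  have hsb := spin_pos_of_spin_pos hab hbP ha hb hA hB hAB (by linarith) hsa
  obtain ⟨m, hm, hneg⟩ := exists_curv_neg hab hbP ha hb hsa hA hB hAB hBA (hfin a b)
  obtain ⟨u, hu, hpu⟩ := exists_right_pos hm.1 ha hsa (hfin a m)
  obtain ⟨v, hv, hpv⟩ := exists_left_pos hm.2 hb hsb (hfin m b)
  obtain ⟨t₁, h₁, hs₁⟩ := exists_signChange_of_pos_of_neg c.continuous_curv hu.2 (hfin u m)
    (hpu u ⟨hu.1, le_rfl⟩).1 hneg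
  obtain ⟨t₂, h₂, hs₂⟩ := exists_signChange_of_neg_of_pos c.continuous_curv hv.1 (hfin m v)
    hneg (hpv v ⟨le_rfl, hv.2⟩).1
  exact ⟨t₁, t₂, hu.1.trans h₁.1, h₁.2.trans h₂.1, h₂.2.trans hv.2, hs₁, hs₂⟩

theorem conj_finite (hfin : ∀ u v, {t ∈ Icc u v | c.curv t = 0}.Finite) :
    ∀ u v, {t ∈ Icc u v | c.conj.curv t = 0}.Finite := by
  simpa [conj_curv] using hfin

theorem isSignChange_of_conj {t : ℝ} (h : IsSignChange c.conj.curv t) : IsSignChange c.curv t := by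
  have : c.conj.curv = fun t => -c.curv t := funext c.conj_curv
  rw [this] at h
  exact h.of_neg

/-- Both arcs between antipodal contacts span exactly π, the borderline case of
`exists_two_signChanges`. The second arc ends at `a + P`. -/
theorem four_signChanges_of_spin_pos {a b : ℝ} (hab : a < b) (hbP : b < a + P)
    (ha : c.f a = 0) (hb : c.f b = 0) (hz : c.z b = -c.z a) (hsa : 0 < c.spin a)
    (hfin : ∀ u v, {t ∈ Icc u v | c.curv t = 0}.Finite) :
    ∃ t : Fin 4 → ℝ, StrictMono t ∧ (∀ i, t i ∈ Ioo a (a + P)) ∧ ∀ i, IsSignChange c.curv (t i) := by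
  have hpi := Real.pi_pos
  obtain ⟨A, -, hA⟩ := exists_angle_Ioc (c.z a) 0
  have hB : IsAngle (A + Real.pi) (c.z b) := hz ▸ hA.add_pi
  have hA' : IsAngle (A + 2 * Real.pi) (c.z (a + P)) := by rw [c.per_z]; exact hA.add_two_pi
  have hsb := spin_pos_of_spin_pos hab hbP ha hb hA hB (by linarith) (by linarith) hsa
  obtain ⟨t₁, t₂, h1, h2, h3, s1, s2⟩ := exists_two_signChanges hab hbP ha hb hsa hA hB
    (by linarith) (by linarith) hfin
  obtain ⟨t₃, t₄, h4, h5, h6, s3, s4⟩ := exists_two_signChanges (a := b) (b := a + P) hbP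
    (by linarith) hb (by rw [c.per_f, ha]) hsb hB hA' (by linarith) (by linarith) hfin
  refine ⟨![t₁, t₂, t₃, t₄], ?_, ?_, ?_⟩
  · rw [Fin.strictMono_iff_lt_succ]
    intro i; fin_cases i <;> simp <;> linarith
  · intro i; fin_cases i <;> simp <;> constructor <;> linarith
  · intro i; fin_cases i <;> simpa

/-- A curve with an antipodal pair of contacts has four curvature sign changes. -/
theorem four_signChanges {a b : ℝ} (hab : a < b) (hbP : b < a + P)
    (ha : c.f a = 0) (hb : c.f b = 0) (hz : c.z b = -c.z a)
    (hfin : ∀ u v, {t ∈ Icc u v | c.curv t = 0}.Finite) :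
    ∃ t : Fin 4 → ℝ, StrictMono t ∧ (∀ i, t i ∈ Ioo a (a + P)) ∧ ∀ i, IsSignChange c.curv (t i) := by
  rcases lt_or_gt_of_ne (spin_ne_zero ha) with h | h
  · obtain ⟨t, h1, h2, h3⟩ := four_signChanges_of_spin_pos (c := c.conj) hab hbP ha hb
      (by simp [hz]) (by rw [conj_spin]; linarith) (conj_finite hfin)
    exact ⟨t, h1, h2, fun i => isSignChange_of_conj (h3 i)⟩
  · exact four_signChanges_of_spin_pos hab hbP ha hb hz h hfin

end HemisphereCurve

/-! ### Triangles of contacts and Carathéodory's theorem -/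

/-- The oriented area of two plane vectors. -/
def area (v w : ℂ) : ℝ := v.re * w.im - v.im * w.re

theorem exists_angle_of_area_pos {v w : ℂ} {A : ℝ} (hA : IsAngle A v) (h : 0 < area v w) :
    ∃ B, A < B ∧ B < A + Real.pi ∧ IsAngle B w := by
  have hpi := Real.pi_pos
  obtain ⟨B, hB, hBw⟩ := exists_angle_Ioc w A
  refine ⟨B, hB.1, ?_, hBw⟩
  by_contra! hle
  have h1 : area v w = ‖v‖ * ‖w‖ * Real.sin (B - A) := by
    rw [area, hA.re, hA.im, hBw.re, hBw.im, Real.sin_sub]; ring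
  have h2 : Real.sin (B - A) ≤ 0 := by
    have := Real.sin_nonneg_of_nonneg_of_le_pi (x := B - A - Real.pi) (by linarith)
      (by linarith [hB.2])
    rw [Real.sin_sub_pi] at this
    linarith
  have := mul_nonneg (mul_nonneg (norm_nonneg v) (norm_nonneg w)) (neg_nonneg.2 h2)
  linarith

namespace HemisphereCurve

variable {P : ℝ} {c : HemisphereCurve P}

theorem six_signChanges_of_area_pos {a b d : ℝ} (hab : a < b) (hbd : b < d) (hd : d < a + P)
    (ha0 : c.f a = 0) (hb0 : c.f b = 0) (hd0 : c.f d = 0)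
    (h1 : 0 < area (c.z a) (c.z b)) (h2 : 0 < area (c.z b) (c.z d))
    (h3 : 0 < area (c.z d) (c.z a)) (hfin : ∀ u v, {t ∈ Icc u v | c.curv t = 0}.Finite) :
    ∃ t : Fin 6 → ℝ, StrictMono t ∧ (∀ i, t i ∈ Ioo a (a + P)) ∧ ∀ i, IsSignChange c.curv (t i) := by
  have hpi := Real.pi_pos
  obtain ⟨A, -, hA⟩ := exists_angle_Ioc (c.z a) 0
  obtain ⟨B, hAB, hBA, hB⟩ := exists_angle_of_area_pos hA h1
  obtain ⟨C, hBC, hCB, hC⟩ := exists_angle_of_area_pos hB h2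
  obtain ⟨D, hCD, hDC, hD⟩ := exists_angle_of_area_pos hC h3
  -- Three steps of less than π return to the direction of `z a` with a total strictly between 0 and
  -- 3π, so the total is one full turn.
  have hDA : D = A + 2 * Real.pi := hD.eq_of_abs_lt hA.add_two_pi (z_ne_zero ha0) (by
    rw [abs_lt]; constructor <;> linarith)
  rw [← c.per_z] at hD
  have hP0 : c.f (a + P) = 0 := by rw [c.per_f, ha0]
  have hsb := spin_pos_of_ordered hab hbd hd.le ha0 hb0 hd0 hA hB hC hAB hBC (by linarith)
  have hsd := spin_pos_of_spin_pos hbd (by linarith) hb0 hd0 hB hC hBC (by linarith) hsb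
  have hsa := spin_pos_of_spin_pos (b := a + P) (by linarith) (by linarith) hb0 hP0 hB hD
    (by linarith) (by linarith) hsb
  rw [c.spin_add_period] at hsa
  obtain ⟨t₁, t₂, k1, k2, k3, s1, s2⟩ := exists_two_signChanges hab (by linarith) ha0 hb0 hsa hA hB
    hAB hBA.le hfin
  obtain ⟨t₃, t₄, k4, k5, k6, s3, s4⟩ := exists_two_signChanges hbd (by linarith) hb0 hd0 hsb hB hC
    hBC hCB.le hfin
  obtain ⟨t₅, t₆, k7, k8, k9, s5, s6⟩ := exists_two_signChanges hd (by linarith) hd0 hP0 hsd hC hD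
    hCD hDC.le hfin
  refine ⟨![t₁, t₂, t₃, t₄, t₅, t₆], ?_, ?_, ?_⟩
  · rw [Fin.strictMono_iff_lt_succ]
    intro i; fin_cases i <;> simp <;> linarith
  · intro i; fin_cases i <;> simp <;> constructor <;> linarith
  · intro i; fin_cases i <;> simpa

theorem area_conj (v w : ℂ) : area ((starRingEnd ℂ) v) ((starRingEnd ℂ) w) = -area v w := by
  simp [area]; ring

theorem area_swap (v w : ℂ) : area v w = -area w v := by
  simp [area]; ring

/-- A curve with three contacts whose convex hull contains the centre in its interior has six
curvature sign changes. -/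
theorem six_signChanges {a b d : ℝ} (hab : a < b) (hbd : b < d) (hd : d < a + P)
    (ha0 : c.f a = 0) (hb0 : c.f b = 0) (hd0 : c.f d = 0) {σ : ℝ}
    (h1 : 0 < σ * area (c.z a) (c.z b)) (h2 : 0 < σ * area (c.z b) (c.z d))
    (h3 : 0 < σ * area (c.z d) (c.z a)) (hfin : ∀ u v, {t ∈ Icc u v | c.curv t = 0}.Finite) :
    ∃ t : Fin 6 → ℝ, StrictMono t ∧ (∀ i, t i ∈ Ioo a (a + P)) ∧ ∀ i, IsSignChange c.curv (t i) := by
  rcases lt_trichotomy σ 0 with hσ | hσ | hσ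
  · obtain ⟨t, k1, k2, k3⟩ := six_signChanges_of_area_pos (c := c.conj) hab hbd hd ha0 hb0 hd0
      (by rw [conj_z, conj_z, area_conj]; nlinarith) (by rw [conj_z, conj_z, area_conj]; nlinarith)
      (by rw [conj_z, conj_z, area_conj]; nlinarith) (conj_finite hfin)
    exact ⟨t, k1, k2, fun i => isSignChange_of_conj (k3 i)⟩
  · simp [hσ] at h1
  · exact six_signChanges_of_area_pos hab hbd hd ha0 hb0 hd0 (by nlinarith) (by nlinarith)
      (by nlinarith) hfin

/-- Among planar vectors whose convex hull contains the origin there is an antipodal pair or a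
triangle around the origin, if all of them have length one. -/
theorem exists_antipodal_or_triangle {S : Set ℂ} (hS : ∀ w ∈ S, ‖w‖ = 1)
    (h0 : (0 : ℂ) ∈ convexHull ℝ S) :
    (∃ v ∈ S, -v ∈ S) ∨
      ∃ u ∈ S, ∃ v ∈ S, ∃ w ∈ S, 0 < area u v ∧ 0 < area v w ∧ 0 < area w u := by
  obtain ⟨ι, hι, z, w, hz, haff, hw, hw1, hsum⟩ := eq_pos_convex_span_of_mem_convexHull h0
  have hzS : ∀ i, z i ∈ S := fun i => hz ⟨i, rfl⟩
  have hcard : Fintype.card ι ≤ 3 := by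
    have h1 := haff.card_le_finrank_succ
    have h2 := Submodule.finrank_le (vectorSpan ℝ (range z))
    rw [Complex.finrank_real_complex] at h2
    omega
  have hinj := haff.injective
  obtain ⟨n, hn⟩ : ∃ n, n = Fintype.card ι := ⟨_, rfl⟩
  let e : Fin n ≃ ι := (finCongr hn).trans (Fintype.equivFin ι).symm
  rw [← e.sum_comp] at hsum
  have hre := congrArg Complex.re hsum
  have him := congrArg Complex.im hsum
  rw [← hn] at hcard
  have hne : n ≠ 0 := by
    rintro rfl
    rw [← e.sum_comp] at hw1
    simp at hw1
  have hnorm : ∀ i, (z i).re ^ 2 + (z i).im ^ 2 = 1 := fun i => by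
    have := hS _ (hzS i)
    have h2 := Complex.normSq_eq_norm_sq (z i)
    rw [this, Complex.normSq_apply] at h2
    linarith
  interval_cases n
  · exact absurd rfl hne
  · simp at hre him
    have := hw (e 0)
    have h1 := hnorm (e 0)
    rw [hre.resolve_left this.ne', him.resolve_left this.ne'] at h1
    norm_num at h1
  · left
    refine ⟨z (e 0), hzS _, ?_⟩
    have : z (e 1) = -z (e 0) := by
      simp [Fin.sum_univ_two] at hre him
      have h0 := hw (e 0)
      have h1 := hw (e 1)
      have n0 := hnorm (e 0)
      have n1 := hnorm (e 1)
      -- The two weighted vectors are opposite and the vectors have length one, so the weights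
      -- agree.
      have hww : w (e 0) = w (e 1) := by
        have : w (e 0) ^ 2 = w (e 1) ^ 2 := by
          have a1 : w (e 0) * (z (e 0)).re = -(w (e 1) * (z (e 1)).re) := by linarith
          have a2 : w (e 0) * (z (e 0)).im = -(w (e 1) * (z (e 1)).im) := by linarith
          have a3 : (w (e 0) * (z (e 0)).re) ^ 2 + (w (e 0) * (z (e 0)).im) ^ 2 =
            (w (e 1) * (z (e 1)).re) ^ 2 + (w (e 1) * (z (e 1)).im) ^ 2 := by
            rw [a1, a2]; ring
          linear_combination a3 - w (e 0) ^ 2 * n0 + w (e 1) ^ 2 * n1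
        nlinarith
      rw [hww] at hre him
      refine Complex.ext ?_ ?_
      · rw [Complex.neg_re]
        apply mul_left_cancel₀ h1.ne'; linarith
      · rw [Complex.neg_im]
        apply mul_left_cancel₀ h1.ne'; linarith
    rw [← this]; exact hzS _
  · by_cases hanti : ∃ v ∈ S, -v ∈ S
    · exact Or.inl hanti
    right
    simp [Fin.sum_univ_three] at hre him
    set z0 := z (e 0) with hz0
    set z1 := z (e 1) with hz1
    set z2 := z (e 2) with hz2
    have w0 := hw (e 0)
    have w1 := hw (e 1)
    have w2 := hw (e 2)
    -- Pairing the relation `∑ w z = 0` with a vertex shows that the three areas have the same sign.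
    have e1 : w (e 1) * area z0 z1 = w (e 2) * area z2 z0 := by
      simp only [area]; linear_combination z0.re * him - z0.im * hre
    have e2 : w (e 2) * area z1 z2 = w (e 0) * area z0 z1 := by
      simp only [area]; linear_combination z1.re * him - z1.im * hre
    -- Parallel unit vectors are equal or opposite; affine independence excludes the first and the
    -- absence of an antipodal pair the second.
    have hne : area z0 z1 ≠ 0 := by
      intro h
      have n0 : z0.re ^ 2 + z0.im ^ 2 = 1 := hnorm (e 0)
      have n1 : z1.re ^ 2 + z1.im ^ 2 = 1 := hnorm (e 1)
      obtain ⟨r, hr⟩ : ∃ r, r = z0.re * z1.re + z0.im * z1.im := ⟨_, rfl⟩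
      have hr1 : z1.re = r * z0.re := by
        rw [area] at h; rw [hr]; linear_combination (-z1.re) * n0 - z0.im * h
      have hr2 : z1.im = r * z0.im := by
        rw [area] at h; rw [hr]; linear_combination (-z1.im) * n0 + z0.re * h
      have hrr : r ^ 2 = 1 := by
        rw [hr1, hr2] at n1; linear_combination n1 - r ^ 2 * n0
      rcases mul_self_eq_one_iff.1 ((sq r).symm.trans hrr) with h | h
      · have : e 1 = e 0 := hinj (Complex.ext (by rw [← hz1, hr1, h, one_mul])
          (by rw [← hz1, hr2, h, one_mul]))
        simpa using e.injective this
      · refine hanti ⟨z0, hzS _, ?_⟩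
        rw [show -z0 = z1 from Complex.ext (by rw [hr1, h]; simp) (by rw [hr2, h]; simp)]
        exact hzS _
    rcases lt_or_gt_of_ne hne with h | h
    · have h2 : area z2 z0 < 0 := by
        by_contra! hc
        have := mul_pos w1 (neg_pos.2 h)
        have := mul_nonneg w2.le hc
        linarith
      have h3 : area z1 z2 < 0 := by
        by_contra! hc
        have := mul_pos w0 (neg_pos.2 h)
        have := mul_nonneg w2.le hc
        linarith
      exact ⟨z0, hzS _, z2, hzS _, z1, hzS _, by rw [area_swap]; linarith,
        by rw [area_swap]; linarith, by rw [area_swap]; linarith⟩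
    · have h2 : 0 < area z2 z0 := by
        by_contra! hc
        have := mul_pos w1 h
        have := mul_nonneg w2.le (neg_nonneg.2 hc)
        linarith
      have h3 : 0 < area z1 z2 := by
        by_contra! hc
        have := mul_pos w0 h
        have := mul_nonneg w2.le (neg_nonneg.2 hc)
        linarith
      exact ⟨z0, hzS _, z1, hzS _, z2, hzS _, h, h3, h2⟩

end HemisphereCurve

/-! ### From the spherical curve to coordinates -/

/-- The lift of a closed spherical curve to the line, as a map to 3-space. -/
def lift (γ : S1 → S2) (x : ℝ) : E3 := (γ (x : S1) : E3)

/-- The coordinate along the first vector of an orthonormal basis. -/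
def heightCLM (b : OrthonormalBasis (Fin 3) ℝ E3) : E3 →L[ℝ] ℝ := innerSL ℝ (b 0)

/-- The coordinates along the last two vectors of an orthonormal basis, as a complex number. -/
def planeCLM (b : OrthonormalBasis (Fin 3) ℝ E3) : E3 →L[ℝ] ℂ :=
  (innerSL ℝ (b 1)).smulRight (1 : ℂ) + (innerSL ℝ (b 2)).smulRight Complex.I

theorem heightCLM_apply (b : OrthonormalBasis (Fin 3) ℝ E3) (v : E3) :
    heightCLM b v = inner ℝ (b 0) v := rfl

theorem planeCLM_re (b : OrthonormalBasis (Fin 3) ℝ E3) (v : E3) :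
    (planeCLM b v).re = inner ℝ (b 1) v := by
  simp [planeCLM]

theorem planeCLM_im (b : OrthonormalBasis (Fin 3) ℝ E3) (v : E3) :
    (planeCLM b v).im = inner ℝ (b 2) v := by
  simp [planeCLM]

theorem ext_of_coordinates (b : OrthonormalBasis (Fin 3) ℝ E3) {v w : E3}
    (h1 : planeCLM b v = planeCLM b w) (h2 : heightCLM b v = heightCLM b w) : v = w := by
  refine b.repr.injective (PiLp.ext fun i => ?_)
  rw [OrthonormalBasis.repr_apply_apply, OrthonormalBasis.repr_apply_apply]
  fin_cases i
  · exact h2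
  · have := congrArg Complex.re h1
    rwa [planeCLM_re, planeCLM_re] at this
  · have := congrArg Complex.im h1
    rwa [planeCLM_im, planeCLM_im] at this

theorem exists_basis (u : S2) : ∃ b : OrthonormalBasis (Fin 3) ℝ E3, b 0 = u := by
  have hu : ‖(u : E3)‖ = 1 := by simp
  obtain ⟨b, hb⟩ := Orthonormal.exists_orthonormalBasis_extension_of_card_eq (𝕜 := ℝ) (E := E3)
    (ι := Fin 3) (by simp) (v := fun _ => (u : E3)) (s := {0}) (by
      refine ⟨fun _ => hu, fun i j hij => absurd (Subsingleton.elim i j) hij⟩)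
  exact ⟨b, hb 0 rfl⟩

section Lift

variable {γ : S1 → S2}

theorem hasDerivAt_lift (h : IsC2 γ) (t : ℝ) : HasDerivAt (lift γ) (deriv (lift γ) t) t :=
  ((h.differentiable (by norm_num)) t).hasDerivAt

theorem contDiff_deriv_lift (h : IsC2 γ) : ContDiff ℝ 1 (deriv (lift γ)) := by
  have : ContDiff ℝ (1 + 1) (lift γ) := by rw [one_add_one_eq_two]; exact h
  exact (contDiff_succ_iff_deriv.1 this).2.2

theorem hasDerivAt_deriv_lift (h : IsC2 γ) (t : ℝ) :
    HasDerivAt (deriv (lift γ)) (deriv (deriv (lift γ)) t) t :=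
  (((contDiff_deriv_lift h).differentiable (by norm_num)) t).hasDerivAt

theorem continuous_deriv_deriv_lift (h : IsC2 γ) : Continuous (deriv (deriv (lift γ))) :=
  (contDiff_deriv_lift h).continuous_deriv le_rfl

theorem translate_eq (γ : S1 → S2) (t : ℝ) :
    (fun x : ℝ => (γ ((t : S1) + (x : S1)) : E3)) = fun x => lift γ (t + x) := by
  funext x; rw [lift, AddCircle.coe_add]

theorem velocity_coe (γ : S1 → S2) (t : ℝ) : velocity γ (t : S1) = deriv (lift γ) t := by
  rw [velocity, translate_eq, deriv_comp_const_add, add_zero]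

theorem acceleration_coe (γ : S1 → S2) (t : ℝ) :
    acceleration γ (t : S1) = deriv (deriv (lift γ)) t := by
  rw [acceleration, translate_eq, iteratedDeriv_succ, iteratedDeriv_one]
  have : deriv (fun x => lift γ (t + x)) = fun x => deriv (lift γ) (t + x) :=
    funext fun x => deriv_comp_const_add _ _ _
  rw [this, deriv_comp_const_add, add_zero]

theorem coe_ne_coe_of_lt {s t : ℝ} (h1 : s < t) (h2 : t < s + 2 * Real.pi) :
    (s : S1) ≠ (t : S1) := by
  intro h
  have h0 : ((t - s : ℝ) : S1) = 0 := by rw [AddCircle.coe_sub, h, sub_self]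
  obtain ⟨n, hn⟩ := (AddCircle.coe_eq_zero_iff _).1 h0
  rw [zsmul_eq_mul] at hn
  have hpi := Real.pi_pos
  have hn0 : (0 : ℝ) < n := by
    by_contra! hle
    nlinarith
  have hn1 : (n : ℝ) < 1 := by
    by_contra! hle
    nlinarith
  have : 0 < n := by exact_mod_cast hn0
  have : n < 1 := by exact_mod_cast hn1
  omega

/-- A closed regular simple spherical curve in a hemisphere, in coordinates. -/
def toHemisphereCurve (hC2 : IsC2 γ) (hinj : Function.Injective γ) (hreg : IsRegular γ)
    (b : OrthonormalBasis (Fin 3) ℝ E3) (hb : ∀ t, 0 ≤ heightCLM b (γ t : E3)) :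
    HemisphereCurve (2 * Real.pi) where
  z t := planeCLM b (lift γ t)
  dz t := planeCLM b (deriv (lift γ) t)
  ddz t := planeCLM b (deriv (deriv (lift γ)) t)
  f t := heightCLM b (lift γ t)
  df t := heightCLM b (deriv (lift γ) t)
  ddf t := heightCLM b (deriv (deriv (lift γ)) t)
  pos := by positivity
  hz t := (planeCLM b).hasFDerivAt.comp_hasDerivAt t (hasDerivAt_lift hC2 t)
  hdz t := (planeCLM b).hasFDerivAt.comp_hasDerivAt t (hasDerivAt_deriv_lift hC2 t)
  hf t := (heightCLM b).hasFDerivAt.comp_hasDerivAt t (hasDerivAt_lift hC2 t)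
  hdf t := (heightCLM b).hasFDerivAt.comp_hasDerivAt t (hasDerivAt_deriv_lift hC2 t)
  cz := (planeCLM b).continuous.comp (continuous_deriv_deriv_lift hC2)
  cf := (heightCLM b).continuous.comp (continuous_deriv_deriv_lift hC2)
  nonneg t := hb _
  norm_eq t := by
    have h := b.sum_sq_norm_inner_right (lift γ t)
    have hn : ‖lift γ t‖ = 1 := by simp [lift]
    rw [hn, Fin.sum_univ_three] at h
    simp only [Real.norm_eq_abs, sq_abs] at h
    rw [planeCLM_re, planeCLM_im, heightCLM_apply]
    linarith
  per_z t := by simp only [lift, AddCircle.coe_add_period]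
  per_f t := by simp only [lift, AddCircle.coe_add_period]
  inj s t h1 h2 h3 h4 := coe_ne_coe_of_lt h1 h2 (hinj (Subtype.ext (ext_of_coordinates b h3 h4)))
  reg t h1 h2 := by
    refine hreg t ?_
    rw [IsSingularPoint, velocity_coe]
    exact ext_of_coordinates b (by rw [h1, map_zero]) (by rw [h2, map_zero])

/-- The determinant of an orthonormal basis. -/
def frameDet (b : OrthonormalBasis (Fin 3) ℝ E3) : ℝ := (Matrix.of fun i j => b i j).det

theorem frameDet_ne_zero (b : OrthonormalBasis (Fin 3) ℝ E3) : frameDet b ≠ 0 := by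
  have h : (Matrix.of fun i j => b i j) * (Matrix.of fun i j => b i j).transpose = 1 := by
    ext i j
    have := orthonormal_iff_ite.1 b.orthonormal j i
    rw [PiLp.inner_apply] at this
    simp only [Matrix.mul_apply, Matrix.transpose_apply, Matrix.of_apply, Matrix.one_apply]
    simp only [RCLike.inner_apply, conj_trivial] at this
    rw [this]
    simp [eq_comm]
  have h2 := congrArg Matrix.det h
  rw [Matrix.det_mul, Matrix.det_one] at h2
  exact left_ne_zero_of_mul_eq_one h2

theorem inner_cross_eq (p v a : E3) : inner ℝ a (cross p v) =
    a 0 * (p 1 * v 2 - p 2 * v 1) + a 1 * (p 2 * v 0 - p 0 * v 2) + a 2 * (p 0 * v 1 - p 1 * v 0) := by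
  rw [PiLp.inner_apply, Fin.sum_univ_three]
  simp [cross, crossProduct]
  ring

theorem inner_eq_sum (v w : E3) : inner ℝ v w = v 0 * w 0 + v 1 * w 1 + v 2 * w 2 := by
  rw [PiLp.inner_apply, Fin.sum_univ_three]
  simp
  ring

/-- Passing to the coordinates of an orthonormal basis multiplies the triple product by the
determinant of the basis, which may be negative but not zero. -/
theorem curv_toHemisphereCurve (hC2 : IsC2 γ) (hinj : Function.Injective γ) (hreg : IsRegular γ)
    (b : OrthonormalBasis (Fin 3) ℝ E3) (hb : ∀ t, 0 ≤ heightCLM b (γ t : E3)) (t : ℝ) :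
    (toHemisphereCurve hC2 hinj hreg b hb).curv t =
      frameDet b * inner ℝ (deriv (deriv (lift γ)) t) (cross (lift γ t) (deriv (lift γ) t)) := by
  rw [HemisphereCurve.curv, inner_cross_eq, frameDet, Matrix.det_fin_three]
  simp only [toHemisphereCurve, planeCLM_re, planeCLM_im, heightCLM_apply, inner_eq_sum,
    Matrix.of_apply]
  ring

theorem geodesicCurvature_coe (hC2 : IsC2 γ) (hinj : Function.Injective γ) (hreg : IsRegular γ)
    (b : OrthonormalBasis (Fin 3) ℝ E3) (hb : ∀ t, 0 ≤ heightCLM b (γ t : E3)) (t : ℝ) :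
    0 < ‖deriv (lift γ) t‖ ^ 3 ∧ (toHemisphereCurve hC2 hinj hreg b hb).curv t =
      frameDet b * ‖deriv (lift γ) t‖ ^ 3 * geodesicCurvature γ (t : S1) := by
  have h0 : deriv (lift γ) t ≠ 0 := by
    rw [← velocity_coe]; exact hreg t
  have h1 : 0 < ‖deriv (lift γ) t‖ ^ 3 := by positivity
  refine ⟨h1, ?_⟩
  rw [curv_toHemisphereCurve, geodesicCurvature, velocity_coe, acceleration_coe, mul_assoc,
    mul_div_cancel₀ _ h1.ne']
  rfl

theorem curv_eq_zero_iff (hC2 : IsC2 γ) (hinj : Function.Injective γ) (hreg : IsRegular γ)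
    (b : OrthonormalBasis (Fin 3) ℝ E3) (hb : ∀ t, 0 ≤ heightCLM b (γ t : E3)) (t : ℝ) :
    (toHemisphereCurve hC2 hinj hreg b hb).curv t = 0 ↔ IsInflection γ (t : S1) := by
  obtain ⟨h1, h2⟩ := geodesicCurvature_coe hC2 hinj hreg b hb t
  rw [h2, mul_eq_zero, or_iff_right (mul_ne_zero (frameDet_ne_zero b) h1.ne'), IsInflection,
    and_iff_right (hreg t)]

theorem isGenuineInflection_of_isSignChange (hC2 : IsC2 γ) (hinj : Function.Injective γ)
    (hreg : IsRegular γ) (b : OrthonormalBasis (Fin 3) ℝ E3)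
    (hb : ∀ t, 0 ≤ heightCLM b (γ t : E3)) {t : ℝ}
    (h : IsSignChange (toHemisphereCurve hC2 hinj hreg b hb).curv t) :
    IsGenuineInflection γ (t : S1) := by
  obtain ⟨h0, ε, hε, h1, x, hx, y, hy, h2, h3⟩ := h
  refine ⟨(curv_eq_zero_iff hC2 hinj hreg b hb t).1 h0,
    (fun x : ℝ => (x : S1)) '' Ioo (t - ε) (t + ε), ?_, ?_, ?_, fun s _ => hreg s, ?_, ?_⟩
  · exact QuotientAddGroup.isOpenMap_coe _ isOpen_Ioo
  · exact (isConnected_Ioo (by linarith)).image _ (AddCircle.continuous_mk' _).continuousOn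
  · exact ⟨t, ⟨by linarith, by linarith⟩, rfl⟩
  · rintro _ ⟨s, hs, rfl⟩ hk
    rw [h1 s hs ((curv_eq_zero_iff hC2 hinj hreg b hb s).2 ⟨hreg s, hk⟩)]
  · obtain ⟨px, ex⟩ := geodesicCurvature_coe hC2 hinj hreg b hb x
    obtain ⟨py, ey⟩ := geodesicCurvature_coe hC2 hinj hreg b hb y
    rw [ex] at h2
    rw [ey] at h3
    -- A negatively oriented basis exchanges the points of negative and of positive curvature.
    rcases lt_or_gt_of_ne (frameDet_ne_zero b) with hδ | hδ
    · refine ⟨y, ⟨y, hy, rfl⟩, x, ⟨x, hx, rfl⟩, ?_, ?_⟩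
      · by_contra! hc
        exact absurd h3 (not_lt.2 (mul_nonpos_of_nonpos_of_nonneg
            (mul_neg_of_neg_of_pos hδ py).le hc))
      · by_contra! hc
        exact absurd h2 (not_lt.2 (mul_nonneg_of_nonpos_of_nonpos
            (mul_neg_of_neg_of_pos hδ px).le hc))
    · refine ⟨x, ⟨x, hx, rfl⟩, y, ⟨y, hy, rfl⟩, ?_, ?_⟩
      · by_contra! hc
        exact absurd h2 (not_lt.2 (mul_nonneg (mul_pos hδ px).le hc))
      · exact (pos_iff_pos_of_mul_pos h3).1 (mul_pos hδ py)

theorem finite_Icc_fiber (y : S1) (u v : ℝ) : {x ∈ Icc u v | (x : S1) = y}.Finite := by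
  have hpi := Real.pi_pos
  obtain ⟨x₀, rfl⟩ := QuotientAddGroup.mk_surjective y
  refine ((Set.finite_Icc ⌊(u - x₀) / (2 * Real.pi)⌋ ⌈(v - x₀) / (2 * Real.pi)⌉).image
    fun n : ℤ => x₀ + n * (2 * Real.pi)).subset ?_
  rintro x ⟨hx, hxy⟩
  have h0 : ((x - x₀ : ℝ) : S1) = 0 := by rw [AddCircle.coe_sub, hxy]; exact sub_self _
  obtain ⟨n, hn⟩ := (AddCircle.coe_eq_zero_iff _).1 h0
  rw [zsmul_eq_mul] at hn
  have hn' : (n : ℝ) = (x - x₀) / (2 * Real.pi) := by rw [← hn]; field_simp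
  refine ⟨n, ⟨?_, ?_⟩, by simp only; linarith⟩
  · have : (⌊(u - x₀) / (2 * Real.pi)⌋ : ℝ) ≤ n := by
      refine (Int.floor_le _).trans ?_
      rw [hn']; gcongr; exact hx.1
    exact_mod_cast this
  · have : (n : ℝ) ≤ ⌈(v - x₀) / (2 * Real.pi)⌉ := by
      refine le_trans ?_ (Int.le_ceil _)
      rw [hn']; gcongr; exact hx.2
    exact_mod_cast this

theorem finite_zeros_curv (hC2 : IsC2 γ) (hinj : Function.Injective γ) (hreg : IsRegular γ)
    (b : OrthonormalBasis (Fin 3) ℝ E3) (hb : ∀ t, 0 ≤ heightCLM b (γ t : E3))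
    (hfin : {t | IsInflection γ t}.Finite) (u v : ℝ) :
    {t ∈ Icc u v | (toHemisphereCurve hC2 hinj hreg b hb).curv t = 0}.Finite := by
  refine (hfin.biUnion fun y _ => finite_Icc_fiber y u v).subset ?_
  rintro t ⟨ht, h0⟩
  rw [curv_eq_zero_iff] at h0
  exact mem_biUnion h0 ⟨ht, rfl⟩

theorem le_numGenuineInflections (hC2 : IsC2 γ) (hinj : Function.Injective γ)
    (hreg : IsRegular γ) (b : OrthonormalBasis (Fin 3) ℝ E3)
    (hb : ∀ t, 0 ≤ heightCLM b (γ t : E3)) {n : ℕ} {a : ℝ} {t : Fin n → ℝ} (ht : StrictMono t)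
    (hta : ∀ i, t i ∈ Ioo a (a + 2 * Real.pi))
    (h : ∀ i, IsSignChange (toHemisphereCurve hC2 hinj hreg b hb).curv (t i)) :
    (n : ℕ∞) ≤ numGenuineInflections γ := by
  have hinj' : Function.Injective fun i => (t i : S1) := by
    intro i j hij
    by_contra hne
    rcases lt_or_gt_of_ne hne with h | h
    · exact coe_ne_coe_of_lt (ht h) (by linarith [(hta i).1, (hta j).2]) hij
    · exact coe_ne_coe_of_lt (ht h) (by linarith [(hta j).1, (hta i).2]) hij.symm
  have h1 : (range fun i => (t i : S1)).encard = n := by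
    rw [← image_univ, hinj'.injOn.encard_image, encard_univ]; simp
  rw [← h1, numGenuineInflections]
  refine encard_le_encard ?_
  rintro _ ⟨i, rfl⟩
  exact isGenuineInflection_of_isSignChange hC2 hinj hreg b hb (h i)

/-! ### Contacts of the given curve and the count -/

theorem exists_rep (y : S1) : ∃ x ∈ Ico (0 : ℝ) (2 * Real.pi), (x : S1) = y := by
  have : Fact (0 < 2 * Real.pi) := ⟨by positivity⟩
  have h := AddCircle.coe_image_Ico_eq (2 * Real.pi) 0
  rw [zero_add] at h
  have : y ∈ (univ : Set S1) := mem_univ _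
  rw [← h] at this
  exact this

/-- The positions of the contacts of the curve with the equator. -/
def contactPositions (c : HemisphereCurve (2 * Real.pi)) : Set ℂ :=
  {w | ∃ x ∈ Ico (0 : ℝ) (2 * Real.pi), c.f x = 0 ∧ c.z x = w}

/-- Nonnegative heights with positive weights sum to zero only if each of them is zero, so the
combination representing the origin uses contacts alone. -/
theorem zero_mem_convexHull_contactPositions (hC2 : IsC2 γ) (hinj : Function.Injective γ)
    (hreg : IsRegular γ) (b : OrthonormalBasis (Fin 3) ℝ E3)
    (hb : ∀ t, 0 ≤ heightCLM b (γ t : E3)) (hconv : OriginInConvexHull γ) :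
    (0 : ℂ) ∈ convexHull ℝ (contactPositions (toHemisphereCurve hC2 hinj hreg b hb)) := by
  obtain ⟨ι, hι, p, w, hp, -, hw, hw1, hsum⟩ := eq_pos_convex_span_of_mem_convexHull hconv
  have hp' : ∀ i, ∃ t, (γ t : E3) = p i := fun i => hp ⟨i, rfl⟩
  have hge : ∀ i, 0 ≤ heightCLM b (p i) := fun i => by
    obtain ⟨t, ht⟩ := hp' i
    rw [← ht]; exact hb t
  have hh : ∀ i, heightCLM b (p i) = 0 := by
    have h := congrArg (heightCLM b) hsum
    rw [map_sum, map_zero] at h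
    simp only [map_smul, smul_eq_mul] at h
    intro i
    have := (Finset.sum_eq_zero_iff_of_nonneg fun j _ => mul_nonneg (hw j).le (hge j)).1 h i
      (Finset.mem_univ i)
    exact (mul_eq_zero.1 this).resolve_left (hw i).ne'
  refine mem_convexHull_of_exists_fintype w (fun i => planeCLM b (p i)) (fun i => (hw i).le) hw1
    (fun i => ?_) ?_
  · obtain ⟨t, ht⟩ := hp' i
    obtain ⟨x, hx, rfl⟩ := exists_rep t
    refine ⟨x, hx, ?_, ?_⟩
    · change heightCLM b (γ (x : S1) : E3) = 0
      rw [ht, hh]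
    · change planeCLM b (γ (x : S1) : E3) = _
      rw [ht]
  · have h := congrArg (planeCLM b) hsum
    rw [map_sum, map_zero] at h
    simpa only [map_smul] using h

theorem numPairs_pos {s t : S1} (hne : s ≠ t) (h : γ s = -γ t) : 1 ≤ numPairs γ := by
  rw [numPairs, one_le_encard_iff_nonempty]
  exact ⟨s(s, t), s, t, rfl, hne, Or.inr h⟩

/-- Genuine inflections of a simple closed curve in a hemisphere, with the origin in its convex
hull. -/
theorem genuineInflections_dichotomy (hC2 : IsC2 γ) (hinj : Function.Injective γ)
    (hreg : IsRegular γ) (hhemi : LiesInHemisphere γ) (hconv : OriginInConvexHull γ)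
    (hfin : {t | IsInflection γ t}.Finite) :
    (4 ≤ numGenuineInflections γ ∧ 1 ≤ numPairs γ) ∨ 6 ≤ numGenuineInflections γ := by
  obtain ⟨u, hu⟩ := hhemi
  obtain ⟨b, hbu⟩ := exists_basis u
  have hb : ∀ t, 0 ≤ heightCLM b (γ t : E3) := fun t => by
    rw [heightCLM_apply, hbu]; exact hu ⟨t, rfl⟩
  set c := toHemisphereCurve hC2 hinj hreg b hb with hc
  have hz := finite_zeros_curv hC2 hinj hreg b hb hfin
  have h0 := zero_mem_convexHull_contactPositions hC2 hinj hreg b hb hconv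
  have hnorm : ∀ w ∈ contactPositions c, ‖w‖ = 1 := by
    rintro _ ⟨x, -, hx, rfl⟩
    exact HemisphereCurve.norm_z hx
  have hpi := Real.pi_pos
  rcases HemisphereCurve.exists_antipodal_or_triangle hnorm h0 with
    ⟨_, ⟨x, hx, hx0, rfl⟩, y, hy, hy0, hxy⟩ |
    ⟨_, ⟨x, hx, hx0, rfl⟩, _, ⟨y, hy, hy0, rfl⟩, _, ⟨t, ht, ht0, rfl⟩, h1, h2, h3⟩
  · left
    have key : ∀ x ∈ Ico 0 (2 * Real.pi), ∀ y ∈ Ico 0 (2 * Real.pi), c.f x = 0 → c.f y = 0 →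
        c.z y = -c.z x → x < y → 4 ≤ numGenuineInflections γ ∧ 1 ≤ numPairs γ := by
      intro x hx y hy hx0 hy0 hxy hlt
      have hlt' : y < x + 2 * Real.pi := by linarith [hx.1, hy.2]
      obtain ⟨t, k1, k2, k3⟩ := HemisphereCurve.four_signChanges hlt hlt' hx0 hy0 hxy hz
      refine ⟨by exact_mod_cast le_numGenuineInflections hC2 hinj hreg b hb k1 k2 k3, ?_⟩
      refine numPairs_pos (coe_ne_coe_of_lt hlt hlt').symm (Subtype.ext ?_)
      have e : lift γ y = -lift γ x := ext_of_coordinates b (by rw [map_neg]; exact hxy)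
        (by rw [map_neg]; exact hy0.trans (by rw [show heightCLM b (lift γ x) = 0 from hx0, neg_zero]))
      exact e
    rcases lt_trichotomy x y with h | h | h
    · exact key x hx y hy hx0 hy0 hxy h
    · rw [← h] at hxy
      have := HemisphereCurve.z_ne_zero hx0
      exact absurd (self_eq_neg.1 hxy) this
    · exact key y hy x hx hy0 hx0 (by rw [hxy, neg_neg]) h
  · right
    -- The triangle comes in its order on the equator, while the arcs are taken in order of time; `σ
    -- = ±1` records whether sorting the times reverses the orientation.
    have key : ∀ x ∈ Ico 0 (2 * Real.pi), ∀ y ∈ Ico 0 (2 * Real.pi), ∀ t ∈ Ico 0 (2 * Real.pi),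
        c.f x = 0 → c.f y = 0 → c.f t = 0 → ∀ σ : ℝ, 0 < σ * area (c.z x) (c.z y) →
        0 < σ * area (c.z y) (c.z t) → 0 < σ * area (c.z t) (c.z x) → x < y → y < t →
        6 ≤ numGenuineInflections γ := by
      intro x hx y hy t ht hx0 hy0 ht0 σ h1 h2 h3 hxy hyt
      obtain ⟨t, k1, k2, k3⟩ := HemisphereCurve.six_signChanges hxy hyt
        (by linarith [hx.1, ht.2]) hx0 hy0 ht0 h1 h2 h3 hz
      exact_mod_cast le_numGenuineInflections hC2 hinj hreg b hb k1 k2 k3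
    have hself : ∀ w : ℂ, ¬ 0 < area w w := fun w => by simp [area, mul_comm]
    have hsw := HemisphereCurve.area_swap
    rcases lt_trichotomy x y with a1 | a1 | a1
    · rcases lt_trichotomy y t with a2 | a2 | a2
      · exact key x hx y hy t ht hx0 hy0 ht0 1 (by linarith) (by linarith) (by linarith) a1 a2
      · rw [a2] at h2; exact absurd h2 (hself _)
      · rcases lt_trichotomy x t with a3 | a3 | a3
        · exact key x hx t ht y hy hx0 ht0 hy0 (-1) (by rw [hsw]; linarith) (by rw [hsw]; linarith)
            (by rw [hsw]; linarith) a3 a2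
        · rw [a3] at h3; exact absurd h3 (hself _)
        · exact key t ht x hx y hy ht0 hx0 hy0 1 (by linarith) (by linarith) (by linarith) a3 a1
    · rw [a1] at h1; exact absurd h1 (hself _)
    · rcases lt_trichotomy x t with a2 | a2 | a2
      · exact key y hy x hx t ht hy0 hx0 ht0 (-1) (by rw [hsw]; linarith) (by rw [hsw]; linarith)
            (by rw [hsw]; linarith) a1 a2
      · rw [a2] at h3; exact absurd h3 (hself _)
      · rcases lt_trichotomy y t with a3 | a3 | a3
        · exact key y hy t ht x hx hy0 ht0 hx0 1 (by linarith) (by linarith) (by linarith) a3 a2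
        · rw [a3] at h2; exact absurd h2 (hself _)
        · exact key t ht y hy x hx ht0 hy0 hx0 (-1) (by rw [hsw]; linarith)
            (by rw [hsw]; linarith) (by rw [hsw]; linarith) a3 a1

/-- A symmetric curve in a hemisphere is a great circle and has infinitely many inflections. -/
theorem infinite_inflections_of_isSymmetric (hC2 : IsC2 γ) (hinj : Function.Injective γ)
    (hreg : IsRegular γ) (hhemi : LiesInHemisphere γ) (hsymm : IsSymmetric γ) :
    {t | IsInflection γ t}.Infinite := by
  intro hfin
  obtain ⟨u, hu⟩ := hhemi
  obtain ⟨b, hbu⟩ := exists_basis u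
  have hb : ∀ t, 0 ≤ heightCLM b (γ t : E3) := fun t => by
    rw [heightCLM_apply, hbu]; exact hu ⟨t, rfl⟩
  set c := toHemisphereCurve hC2 hinj hreg b hb with hc
  -- The antipode of each point is on the curve too, so its height is both nonnegative and
  -- nonpositive.
  have hf : ∀ t, c.f t = 0 := by
    intro t
    have h1 : -γ (t : S1) ∈ range γ := by rw [hsymm]; exact ⟨t, rfl⟩
    obtain ⟨s, hs⟩ := h1
    have h2 := hb s
    rw [hs] at h2
    have h3 : heightCLM b ((-γ (t : S1) : S2) : E3) = -c.f t := map_neg (heightCLM b) _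
    rw [h3] at h2
    linarith [c.nonneg t]
  have hdf : ∀ t, c.df t = 0 := fun t => HemisphereCurve.df_eq_zero (hf t)
  have hddf : ∀ t, c.ddf t = 0 := fun t => by
    have h := c.hdf t
    rw [show c.df = fun _ => 0 from funext hdf] at h
    exact h.unique (hasDerivAt_const t 0)
  have hz := finite_zeros_curv hC2 hinj hreg b hb hfin 0 1
  refine Icc_infinite (zero_lt_one' ℝ) (hz.subset fun t ht => ⟨ht, ?_⟩)
  rw [HemisphereCurve.curv, hf, hdf, hddf]; simp

end Lift

end SphericalCurve

end

theorem corollary3p3 (γ : SphericalCurve.S1 → SphericalCurve.S2)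
    (hC2 : SphericalCurve.IsC2 γ)
    (hsimple : Function.Injective γ)
    (hreg : SphericalCurve.IsRegular γ)
    (hhemi : SphericalCurve.LiesInHemisphere γ)
    (hconv : SphericalCurve.OriginInConvexHull γ) :
    (6 ≤ 2 * (SphericalCurve.numPairs γ + SphericalCurve.numSingular γ)
        + SphericalCurve.numInflections γ ∧
      4 ≤ 2 * (SphericalCurve.numDoublePairs γ + SphericalCurve.numSingular γ)
        + SphericalCurve.numInflections γ ∧
      (SphericalCurve.IsSymmetric γ →
        6 ≤ 2 * (SphericalCurve.numDoublePairs γ + SphericalCurve.numSingular γ)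
          + SphericalCurve.numInflections γ)) ∧
    ({t | SphericalCurve.IsInflection γ t}.Finite →
      6 ≤ 2 * (SphericalCurve.numPairs γ + SphericalCurve.numSingular γ)
        + SphericalCurve.numGenuineInflections γ ∧
      4 ≤ 2 * (SphericalCurve.numDoublePairs γ + SphericalCurve.numSingular γ)
        + SphericalCurve.numGenuineInflections γ ∧
      (SphericalCurve.IsSymmetric γ →
        6 ≤ 2 * (SphericalCurve.numDoublePairs γ + SphericalCurve.numSingular γ)
          + SphericalCurve.numGenuineInflections γ)) := by
  have hgenuine : {t | SphericalCurve.IsInflection γ t}.Finite →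
      6 ≤ 2 * (SphericalCurve.numPairs γ + SphericalCurve.numSingular γ)
        + SphericalCurve.numGenuineInflections γ ∧
      4 ≤ 2 * (SphericalCurve.numDoublePairs γ + SphericalCurve.numSingular γ)
        + SphericalCurve.numGenuineInflections γ ∧
      (SphericalCurve.IsSymmetric γ →
        6 ≤ 2 * (SphericalCurve.numDoublePairs γ + SphericalCurve.numSingular γ)
          + SphericalCurve.numGenuineInflections γ) := by
    intro hfin
    refine ⟨?_, ?_, fun hsymm => absurd hfin
      (SphericalCurve.infinite_inflections_of_isSymmetric hC2 hsimple hreg hhemi hsymm)⟩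
    · rcases SphericalCurve.genuineInflections_dichotomy hC2 hsimple hreg hhemi hconv hfin with
        ⟨h4, h1⟩ | h6
      -- One antipodal pair, no singular point, and four genuine inflections.
      · calc (6 : ℕ∞) = 2 * (1 + 0) + 4 := by norm_num
          _ ≤ _ := by gcongr; exact zero_le
      · exact le_add_left h6
    · rcases SphericalCurve.genuineInflections_dichotomy hC2 hsimple hreg hhemi hconv hfin with
        ⟨h4, -⟩ | h6
      · exact le_add_left h4
      · exact le_add_left (le_trans (by norm_num) h6)
  refine ⟨?_, hgenuine⟩
  by_cases hfin : {t | SphericalCurve.IsInflection γ t}.Finite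
  · have hle : SphericalCurve.numGenuineInflections γ ≤ SphericalCurve.numInflections γ :=
      Set.encard_le_encard fun t ht => ht.1
    obtain ⟨h1, h2, h3⟩ := hgenuine hfin
    exact ⟨h1.trans (by gcongr), h2.trans (by gcongr), fun h => (h3 h).trans (by gcongr)⟩
  · have htop : SphericalCurve.numInflections γ = ⊤ := Set.encard_eq_top hfin
    rw [htop]
    simp
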